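/- Fix, for every integer $p\ge 1$, a primitive $p$-th root of unity $\zeta_p\in\mathbb C$. **Definitions.** Let $A$ be a commutative $\mathbb C$-algebra with a $\mathbb C$-linear derivation $D$. For $n\in\mathbb Z$ and $a,b\in A$ let $a_nb$ be the coefficient of $x^{-n-1}$ in $\sum_{j\ge 0}\frac1{j!}(D^ja)b\,x^j$; with these products and vacuum $1$, $A$ is a vertex algebra. Let $g$ be a $\mathbb C$-algebra automorphism of $A$ of finite order $p$, and put $A^r=\{u\in A: gu=\zeta_p^ru\}$ for $0\le r<p$. A *$g$-twisted vertex algebra $(A,D)$-module* is a complex vector space $M$ with a linear map $Y_M(\cdot,x)\colon A\to(\operatorname{End}_{\mathbb C}M)[[x^{1/p},x^{-1/p}]]$, $Y_M(u,x)=\sum_{i\in\frac1p\mathbb Z}u_ix^{-i-1}$, such that (i) $u_i=0$ for $u\in A^r$ and $i\notin \frac rp+\mathbb Z$; (ii) $Y_M(u,x)w\in M((x^{1/p}))$ for $u\in A$, $w\in M$; (iii) $Y_M(1,x)=\mathrm{id}_M$; (iv) for $u\in A^r$, $v\in A^s$, $m\in\frac rp+\mathbb Z$, $n\in\frac sp+\mathbb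 Z$, $l\in\mathbb Z$, $$\sum_{i\ge0}\binom mi(u_{l+i}v)_{m+n-i}=\sum_{i\ge0}\binom li(-1)^i\bigl(u_{l+m-i}v_{n+i}+(-1)^{l+1}v_{l+n-i}u_{m+i}\bigr).$$ A *vertex algebra $(A,D)$-module* is the case $g=1$. A submodule is a subspace stable under all $u_i$; a module is *indecomposable* if it is not the direct sum of two nonzero submodules; an isomorphism of $g$-twisted modules is a linear isomorphism commuting with all $u_i$. If $h$ is a $\mathbb C$-algebra automorphism of $A$ commuting with $D$, then $(M,Y_M)\circ h$ is the vector space $M$ with $(Y_M\circ h)(a,x)=Y_M(ha,x)$; it is an $h^{-1}gh$-twisted module. If $M$ is a finite-dimensional $g$-twisted module, the subalgebra $\mathcal A_M(A)\subset\operatorname{End}_{\mathbb C}M$ generated by all $a_i$ is commutative, and $\mathcal A_M(A)=\bigoplus_{k}\mathbb Ce_k\oplus\mathcal J$, where $\mathcal J$ is its Jacobson radical and the $e_k$ are its primitive orthogonal idempotents. The *semisimple part* $X^{[0]}$ of $X\in\mathcal A_M(A)$ is its projection to $\bigoplus_k\mathbb Ce_k$, and $\psi[A,(M,Y_M)]$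 is the map $a\mapsto Y_M(a,x)^{[0]}=\sum_i a_i^{[0]}x^{-i-1}$. **Theorem.** Let $K$ be a field containing $\mathbb C$ with a $\mathbb C$-linear derivation $D$, $G$ a finite group of $\mathbb C$-algebra automorphisms of $K$ commuting with $D$, $K^G$ its fixed field (with the derivation $D|_{K^G}$), and $(M,Y_M)$ a nonzero finite-dimensional indecomposable vertex algebra $(K^G,D)$-module. For $g\in G$, a *$g$-twisted structure over $(M,Y_M)$* is a $g$-twisted vertex algebra $(K,D)$-module $(M,\tilde Y)$ on the same vector space with $\tilde Y(\cdot,x)|_{K^G}=Y_M(\cdot,x)$. Then: 1. There is a $g$-twisted structure over $(M,Y_M)$ for some $g\in G$. 2. If $g\in G$ and $(M,\tilde Y^1)$, $(M,\tilde Y^2)$ are $g$-twisted structures over $(M,Y_M)$ with $\psi[K,(M,\tilde Y^1)]=\psi[K,(M,\tilde Y^2)]$, then $(M,\tilde Y^1)\cong(M,\tilde Y^2)$ as $g$-twisted vertex algebra $(K,D)$-modules. 3. If $g\in G$ and $(M,\tilde Y)$ is a $g$-twisted structure over $(M,Y_M)$, then the maps $\tilde Y\circ h$, $h\in G$, are pairwise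 distinct $\mathbb C$-algebra homomorphisms from $K$ to $(\operatorname{End}_{\mathbb C}M)((x^{1/|g|}))$. 4. If $g_1,g_2\in G$ and $(M,\tilde Y^k)$ is a $g_k$-twisted structure over $(M,Y_M)$ for $k=1,2$, then there is $h\in G$ such that $h^{-1}g_1h=g_2$ and $(M,\tilde Y^1)\circ h\cong(M,\tilde Y^2)$ as $g_2$-twisted vertex algebra $(K,D)$-modules. -/

import Mathlib

noncomputable section

namespace DiffVertex

/-- The `n`-th product `a_n b` of the vertex algebra attached to a commutative `ℂ`-algebra `A`
with derivation `D`, i.e. the coefficient of `x^(-n-1)` in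
`Y(a,x) b = ∑_{j ≥ 0} (1/j!) (D^j a) b x^j`. The vacuum vector is `1`. -/
def nthProduct {A : Type*} [CommRing A] [Algebra ℂ A] (D : Derivation ℂ A A)
    (n : ℤ) (a b : A) : A :=
  if n < 0 then (((-n - 1).toNat.factorial : ℂ)⁻¹) • ((D^[(-n - 1).toNat] a) * b) else 0

/-- `(M, Y)` is a `g`-twisted vertex algebra `(A,D)`-module, where `g` has finite order `p`.
A formal series `Y(a,x) = ∑ a_i x^(-i-1)` in fractional powers of `x` is stored as the family of
its modes, `Y a i = a_i` with `i : ℚ`. The root of unity used for the eigenspaces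
`A^r = {u | g u = ζ_p ^ r u}` is `ζ p`. The identity `jacobi` is applied to a vector `w`, so
that both of its sums are finite (by the definition of `nthProduct` and by `truncation`). -/
structure IsTwistedModule {A M : Type*} [CommRing A] [Algebra ℂ A]
    [AddCommGroup M] [Module ℂ M] (ζ : ℕ → ℂ) (D : Derivation ℂ A A) (g : A ≃ₐ[ℂ] A)
    (Y : A →ₗ[ℂ] (ℚ → Module.End ℂ M)) : Prop where
  finite_order : 0 < orderOf g
  /-- `Y(u,x)` involves only powers of `x^(1/p)`. -/
  support : ∀ (u : A) (i : ℚ), (¬ ∃ k : ℤ, i = (k : ℚ) / (orderOf g : ℚ)) → Y u i = 0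
  /-- `Y(u,x) = ∑_{i ∈ r/p + ℤ} u_i x^(-i-1)` for `u ∈ A^r`. -/
  support_eigen : ∀ (r : ℕ), r < orderOf g → ∀ u : A, g u = (ζ (orderOf g)) ^ r • u →
    ∀ i : ℚ, (¬ ∃ k : ℤ, i = (r : ℚ) / (orderOf g : ℚ) + k) → Y u i = 0
  /-- `Y(u,x) w ∈ M((x^(1/p)))`. -/
  truncation : ∀ (u : A) (w : M), ∃ N : ℚ, ∀ i : ℚ, N ≤ i → Y u i w = 0
  /-- `Y(1,x) = id`. -/
  vacuum : ∀ i : ℚ, Y 1 i = if i = -1 then LinearMap.id else 0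
  jacobi : ∀ (r s : ℕ), r < orderOf g → s < orderOf g → ∀ u v : A,
    g u = (ζ (orderOf g)) ^ r • u → g v = (ζ (orderOf g)) ^ s • v →
    ∀ m n : ℚ, (∃ k : ℤ, m = (r : ℚ) / (orderOf g : ℚ) + k) →
      (∃ k : ℤ, n = (s : ℚ) / (orderOf g : ℚ) + k) →
    ∀ (l : ℤ) (w : M),
      (∑ᶠ i : ℕ, ((Ring.choose m i : ℚ) : ℂ) •
        Y (nthProduct D (l + i) u v) (m + n - i) w) =
      ∑ᶠ i : ℕ, (((Ring.choose l i : ℤ) : ℂ) * (-1) ^ i) •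
        (Y u (l + m - i) (Y v (n + i) w) +
          ((-1 : ℂ) ^ (l + 1)) • Y v (l + n - i) (Y u (m + i) w))

/-- A vertex algebra `(A,D)`-module is the untwisted case `g = 1`. (Then `p = 1`, only `r = 0`
occurs, all modes have integral index, and the choice of roots of unity plays no role.) -/
def IsVertexModule {A M : Type*} [CommRing A] [Algebra ℂ A]
    [AddCommGroup M] [Module ℂ M] (D : Derivation ℂ A A)
    (Y : A →ₗ[ℂ] (ℚ → Module.End ℂ M)) : Prop :=
  IsTwistedModule (fun _ => 1) D 1 Y

/-- `W` is a submodule of `(M, Y)`: a subspace stable under all modes. -/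
def IsStable {A M : Type*} [CommRing A] [Algebra ℂ A] [AddCommGroup M] [Module ℂ M]
    (Y : A →ₗ[ℂ] (ℚ → Module.End ℂ M)) (W : Submodule ℂ M) : Prop :=
  ∀ (a : A) (i : ℚ), ∀ w ∈ W, Y a i w ∈ W

/-- `(M, Y)` is not the direct sum of two nonzero submodules. -/
def IsIndecomposable {A M : Type*} [CommRing A] [Algebra ℂ A] [AddCommGroup M] [Module ℂ M]
    (Y : A →ₗ[ℂ] (ℚ → Module.End ℂ M)) : Prop :=
  ∀ W₁ W₂ : Submodule ℂ M, IsStable Y W₁ → IsStable Y W₂ → IsCompl W₁ W₂ → W₁ = ⊥ ∨ W₂ = ⊥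

/-- Isomorphism of (twisted) modules: a linear isomorphism commuting with all modes. -/
def Isomorphic {A M N : Type*} [CommRing A] [Algebra ℂ A] [AddCommGroup M] [Module ℂ M]
    [AddCommGroup N] [Module ℂ N] (Y₁ : A →ₗ[ℂ] (ℚ → Module.End ℂ M))
    (Y₂ : A →ₗ[ℂ] (ℚ → Module.End ℂ N)) : Prop :=
  ∃ f : M ≃ₗ[ℂ] N, ∀ (a : A) (i : ℚ) (w : M), f (Y₁ a i w) = Y₂ a i (f w)

/-- The translate `Y ∘ h`, with `(Y ∘ h)(a,x) = Y(h a, x)`. -/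
def translate {A M : Type*} [CommRing A] [Algebra ℂ A] [AddCommGroup M] [Module ℂ M]
    (Y : A →ₗ[ℂ] (ℚ → Module.End ℂ M)) (h : A ≃ₐ[ℂ] A) : A →ₗ[ℂ] (ℚ → Module.End ℂ M) :=
  Y.comp h.toLinearMap

/-- The subalgebra of `End M` generated by all modes `a_i`. -/
def modeAlgebra {A M : Type*} [CommRing A] [Algebra ℂ A] [AddCommGroup M] [Module ℂ M]
    (Y : A →ₗ[ℂ] (ℚ → Module.End ℂ M)) : Subalgebra ℂ (Module.End ℂ M) :=
  Algebra.adjoin ℂ {X | ∃ (a : A) (i : ℚ), X = Y a i}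

/-- The semisimple part `X^[0]` of an element `X` of a finite-dimensional commutative
`ℂ`-algebra `B = (⊕ ℂ e_i) ⊕ J`, where `J` is the Jacobson radical and the `e_i` are the
primitive orthogonal idempotents: the unique element of `⊕ ℂ e_i`, which is the linear span of
all idempotents of `B`, that is congruent to `X` modulo `J`. -/
def semisimplePart {B : Type*} [Ring B] [Algebra ℂ B] (X : B) : B :=
  Classical.epsilon fun S : B =>
    S ∈ Submodule.span ℂ {e : B | IsIdempotentElem e} ∧ X - S ∈ Ring.jacobson B

/-- `ψ[A,(M,Y)] = Y(·,x)^[0]`, the semisimple part of `Y` taken coefficientwise (with the same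
indexing of coefficients as for `Y`). -/
def psi {A M : Type*} [CommRing A] [Algebra ℂ A] [AddCommGroup M] [Module ℂ M]
    (Y : A →ₗ[ℂ] (ℚ → Module.End ℂ M)) : A → ℚ → Module.End ℂ M :=
  fun a i => ((semisimplePart
    (⟨Y a i, Algebra.subset_adjoin ⟨a, i, rfl⟩⟩ : modeAlgebra Y) : modeAlgebra Y) :
      Module.End ℂ M)

section Field

variable {K : Type*} [Field K] [Algebra ℂ K]

/-- The restriction of `D` to `K^G`, for a group `G` of automorphisms preserving `D`. -/
def fixedDerivation (D : Derivation ℂ K K) (G : Subgroup (K ≃ₐ[ℂ] K))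
    (hD : ∀ g ∈ G, ∀ a : K, g (D a) = D (g a)) :
    Derivation ℂ (IntermediateField.fixedField G) (IntermediateField.fixedField G) :=
  Derivation.mk'
    { toFun := fun a => ⟨D (a : K), fun g => by
        have h : (g : K ≃ₐ[ℂ] K) (a : K) = a := a.2 g
        have h2 := hD g g.2 (a : K)
        rw [h] at h2
        exact h2⟩
      map_add' := fun a b => Subtype.ext (by simp)
      map_smul' := fun c a => Subtype.ext (by simp) }
    (fun a b => Subtype.ext (by simp))

/-- `(M, Y')` is a `g`-twisted vertex algebra `(K,D)`-module structure over the `K^G`-module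
`(M, Y)`. -/
def IsTwistedStructureOver {M : Type*} [AddCommGroup M] [Module ℂ M] (ζ : ℕ → ℂ)
    (D : Derivation ℂ K K) (G : Subgroup (K ≃ₐ[ℂ] K))
    (Y : IntermediateField.fixedField G →ₗ[ℂ] (ℚ → Module.End ℂ M))
    (g : K ≃ₐ[ℂ] K) (Y' : K →ₗ[ℂ] (ℚ → Module.End ℂ M)) : Prop :=
  IsTwistedModule ζ D g Y' ∧ ∀ a : IntermediateField.fixedField G, Y' (a : K) = Y a

end Field

end DiffVertex

end

/-! A finite-dimensional `g`-twisted module amounts to an algebra homomorphism `T` from `A` to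
series in rational powers of `x` over `End M`, with commuting coefficients. The Jacobi identity for
`l = 0` says that modes commute, for `l = -1` that `T` is multiplicative, and for `l = -2` with `v =
1` that `D` becomes `d/dx`. Conversely these properties give the identity for every `l`. The support
condition says that `g` is the monodromy of the series: it multiplies `u_{k/p}` by `ζ_p ^ k`
(`mode_automorphism`). The two directions are `exists_series` and `isTwistedModule_of_series`.

Let `T₀` be the series of the `K^G`-module. By indecomposability and Fitting's lemma, every operator
commuting with the modes is scalar plus nilpotent. So a commutative algebra of such operators is
local with residue field `ℂ` and nilpotent maximal ideal, and the semisimple part of a series is its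
reduction, a homomorphism `φ` to scalar series. Since `K / K^G` is separable, it is formally étale:
an extension `φ` of the reduction `φ₀` of `T₀` lifts to exactly one extension `T` of `T₀` with
coefficients in a given such algebra. The compatibility with `D` passes from `K^G` to `K` because `K
/ K^G` has no nonzero derivations.

Thus everything is decided by scalar embeddings. Newton–Puiseux gives an extension `φ` of `φ₀`;
Galois theory says that any two extensions differ by an element of `G`. The monodromy `x ^ q ↦ exp
(2πiq) x ^ q` fixes `φ₀`, hence acts on `φ` as some `g₀ ∈ G`, and by unique lifting it acts so on
`T` as well; a power of `g₀` suited to `ζ` is the required `g`. Any twisted structure has its modes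
in the mode algebra of `Y`, so structures with equal reductions are equal, not merely isomorphic.
Structures in general differ by some `h ∈ G`, and the conjugacy of `g₁` and `g₂` is read off from
their monodromies. -/

namespace DiffVertex

open Polynomial

universe w

/-! ### The Newton–Puiseux theorem. -/

/-- A monic polynomial over `ℂ⟦t⟧` whose reduction modulo `t` vanishes at `0` and is not a power
of `X` has a monic factor of smaller positive degree. -/
theorem exists_monic_dvd_of_coeff_zero {f : (PowerSeries ℂ)[X]} (hf : f.Monic)
    (h0 : PowerSeries.constantCoeff (f.coeff 0) = 0)
    (h1 : ∃ i < f.natDegree, PowerSeries.constantCoeff (f.coeff i) ≠ 0) :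
    ∃ f₁ : (PowerSeries ℂ)[X], f₁.Monic ∧ f₁ ∣ f ∧ 0 < f₁.natDegree ∧
      f₁.natDegree < f.natDegree := by
  have hmem : ∀ a : PowerSeries ℂ, a ∈ IsLocalRing.maximalIdeal (PowerSeries ℂ) →
      PowerSeries.constantCoeff a = 0 := by
    intro a ha
    rw [PowerSeries.maximalIdeal_eq_span_X, Ideal.mem_span_singleton] at ha
    exact PowerSeries.X_dvd_iff.1 ha
  have : IsAdicComplete (IsLocalRing.maximalIdeal (PowerSeries ℂ)) (PowerSeries ℂ) := by
    rw [PowerSeries.maximalIdeal_eq_span_X]; infer_instance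
  have hne : PowerSeries.map (IsLocalRing.residue (PowerSeries ℂ)) (f : PowerSeries _) ≠ 0 := by
    intro h
    have := congrArg (PowerSeries.coeff f.natDegree) h
    simp [hf.coeff_natDegree] at this
  obtain ⟨f₁, u, H⟩ := PowerSeries.exists_isWeierstrassFactorization hne
  have hd := H.isDistinguishedAt
  have hdvd : f₁ ∣ f := by
    have hm : f₁.map (Ideal.Quotient.mk (IsLocalRing.maximalIdeal (PowerSeries ℂ))) =
        X ^ f₁.natDegree := hd.map_eq_X_pow
    have hdeg : (((f₁ : PowerSeries (PowerSeries ℂ)).map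
        (Ideal.Quotient.mk (IsLocalRing.maximalIdeal (PowerSeries ℂ)))).order.toNat) =
          f₁.natDegree := by
      rw [← Polynomial.polynomial_map_coe, hm]
      simp
    have hfd : f₁.degree = f₁.natDegree := degree_eq_natDegree hd.monic.ne_zero
    -- Polynomial division by `f₁` and the factorization `f = f₁ * u` are both Weierstrass divisions
    -- of `f` by `f₁`; uniqueness makes the polynomial remainder zero.
    have := hd.isWeierstrassDivisorAt'.eq_of_mul_add_eq_mul_add
      (q := ((f /ₘ f₁ : (PowerSeries ℂ)[X]) : PowerSeries (PowerSeries ℂ))) (q' := u)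
      (r := f %ₘ f₁) (r' := 0)
      (by rw [hdeg, ← hfd]; exact degree_modByMonic_lt _ hd.monic)
      (by simp)
      (by
        rw [Polynomial.coe_zero, add_zero, ← H.eq_mul, ← Polynomial.coe_mul, ← Polynomial.coe_add,
          add_comm, modByMonic_add_div])
    exact (modByMonic_eq_zero_iff_dvd hd.monic).1 this.2
  have hred : f₁.map (PowerSeries.constantCoeff (R := ℂ)) = X ^ f₁.natDegree := by
    ext i
    rw [coeff_map, coeff_X_pow]
    rcases lt_trichotomy i f₁.natDegree with h | h | h
    · rw [if_neg h.ne]; exact hmem _ (hd.mem h)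
    · rw [if_pos h, h, hd.monic.coeff_natDegree]; simp
    · rw [if_neg h.ne', coeff_eq_zero_of_natDegree_lt h]; simp
  -- Modulo `t` the cofactor is a unit, so the degree of `f₁` is the order at `0` of the reduction
  -- of `f`. The hypotheses `h0` and `h1` bound this order from below and above.
  have hfac : ((f.map (PowerSeries.constantCoeff (R := ℂ)) : ℂ[X]) : PowerSeries ℂ) =
      PowerSeries.X ^ f₁.natDegree * PowerSeries.map (PowerSeries.constantCoeff (R := ℂ)) u := by
    have := congrArg (PowerSeries.map (PowerSeries.constantCoeff (R := ℂ))) H.eq_mul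
    rw [map_mul, ← Polynomial.polynomial_map_coe, ← Polynomial.polynomial_map_coe, hred] at this
    simpa using this
  refine ⟨f₁, hd.monic, hdvd, ?_, ?_⟩
  · rw [Nat.pos_iff_ne_zero]
    intro hk
    rw [hk, pow_zero, one_mul] at hfac
    have hu : IsUnit (PowerSeries.map (PowerSeries.constantCoeff (R := ℂ)) u) := H.isUnit.map _
    rw [← hfac, PowerSeries.isUnit_iff_constantCoeff] at hu
    rw [← PowerSeries.coeff_zero_eq_constantCoeff_apply, Polynomial.coeff_coe, coeff_map, h0] at hu
    exact not_isUnit_zero hu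
  · by_contra hk
    push Not at hk
    obtain ⟨i, hi, hi'⟩ := h1
    apply hi'
    have := congrArg (PowerSeries.coeff i) hfac
    rw [PowerSeries.coeff_X_pow_mul', if_neg (by omega)] at this
    simpa using this

/-- A monic polynomial over `ℂ⟦t⟧` whose reduction modulo `t` is not a power of a linear
polynomial has a monic factor of smaller positive degree. -/
theorem exists_monic_dvd_of_map_ne_pow {f : (PowerSeries ℂ)[X]} (hf : f.Monic)
    (hpos : 0 < f.natDegree)
    (h : ∀ α : ℂ, f.map PowerSeries.constantCoeff ≠ (X - C α) ^ f.natDegree) :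
    ∃ f₁ : (PowerSeries ℂ)[X], f₁.Monic ∧ f₁ ∣ f ∧ 0 < f₁.natDegree ∧
      f₁.natDegree < f.natDegree := by
  have hfm : (f.map (PowerSeries.constantCoeff (R := ℂ))).Monic := hf.map _
  have hfn : (f.map (PowerSeries.constantCoeff (R := ℂ))).natDegree = f.natDegree :=
    hf.natDegree_map _
  obtain ⟨α, hα⟩ := IsAlgClosed.exists_root (f.map (PowerSeries.constantCoeff (R := ℂ)))
    (by rw [degree_eq_natDegree hfm.ne_zero, hfn]; exact_mod_cast hpos.ne')
  -- The translation moves a root `α` of the reduction to `0`.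
  set g := f.comp (X + C (PowerSeries.C α)) with hg
  have hgm : g.Monic := hf.comp_X_add_C _
  have hgn : g.natDegree = f.natDegree := by simp [hg, natDegree_comp]
  have hgmap : g.map (PowerSeries.constantCoeff (R := ℂ)) =
      (f.map PowerSeries.constantCoeff).comp (X + C α) := by
    simp [hg, Polynomial.map_comp]
  obtain ⟨f₁, h1, h2, h3, h4⟩ := exists_monic_dvd_of_coeff_zero hgm
    (by
      rw [← coeff_map, hgmap, coeff_zero_eq_eval_zero, eval_comp]
      simpa using hα)
    (by
      by_contra hcon
      push Not at hcon
      apply h α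
      have hX : g.map (PowerSeries.constantCoeff (R := ℂ)) = X ^ f.natDegree := by
        ext i
        rw [coeff_map, coeff_X_pow]
        rcases lt_trichotomy i g.natDegree with h | h | h
        · rw [if_neg (by omega)]; exact hcon i h
        · rw [if_pos (by omega), h, hgm.coeff_natDegree]; simp
        · rw [if_neg (by omega), coeff_eq_zero_of_natDegree_lt h]; simp
      have := congrArg (fun p : ℂ[X] => p.comp (X - C α)) (hgmap.symm.trans hX)
      simpa [comp_assoc] using this)
  refine ⟨f₁.comp (X - C (PowerSeries.C α)), h1.comp_X_sub_C _, ?_, ?_, ?_⟩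
  · obtain ⟨q, hq⟩ := h2
    refine ⟨q.comp (X - C (PowerSeries.C α)), ?_⟩
    rw [← mul_comp, ← hq, hg, comp_assoc]
    simp
  · simpa [natDegree_comp] using h3
  · simpa [natDegree_comp, ← hgn] using h4

/-- The substitution `t ↦ t ^ N` on Laurent series. -/
noncomputable def ramify (N : ℕ) (hN : 0 < N) : LaurentSeries ℂ →+* LaurentSeries ℂ :=
  HahnSeries.embDomainRingHom (AddMonoidHom.mulLeft (N : ℤ))
    (fun a b h => by
      have h' : (N : ℤ) * a = N * b := h
      exact mul_left_cancel₀ (by exact_mod_cast hN.ne') h')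
    (fun a b => by
      have : (0 : ℤ) < N := by exact_mod_cast hN
      change (N : ℤ) * a ≤ N * b ↔ _
      exact mul_le_mul_iff_right₀ this)

theorem coeff_ramify_mul (N : ℕ) (hN : 0 < N) (x : LaurentSeries ℂ) (n : ℤ) :
    (ramify N hN x).coeff (N * n) = x.coeff n :=
  HahnSeries.embDomain_mk_coeff (f := fun n : ℤ => (N : ℤ) * n) _ _

theorem coeff_ramify_eq_zero (N : ℕ) (hN : 0 < N) (x : LaurentSeries ℂ) (n : ℤ)
    (hn : ¬ (N : ℤ) ∣ n) : (ramify N hN x).coeff n = 0 := by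
  apply HahnSeries.embDomain_of_notMem_range
  rintro ⟨m, hm⟩
  exact hn ⟨m, hm.symm⟩

theorem ramify_comp (N N' : ℕ) (hN : 0 < N) (hN' : 0 < N') (x : LaurentSeries ℂ) :
    ramify N hN (ramify N' hN' x) = ramify (N * N') (Nat.mul_pos hN hN') x := by
  ext n
  by_cases h : (N : ℤ) ∣ n
  · obtain ⟨m, rfl⟩ := h
    rw [coeff_ramify_mul]
    by_cases h' : (N' : ℤ) ∣ m
    · obtain ⟨k, rfl⟩ := h'
      rw [coeff_ramify_mul]
      have := coeff_ramify_mul (N * N') (Nat.mul_pos hN hN') x k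
      rw [← this]; push_cast; ring_nf
    · rw [coeff_ramify_eq_zero _ _ _ _ h', coeff_ramify_eq_zero]
      intro hd
      push_cast at hd
      exact h' (Int.dvd_of_mul_dvd_mul_left (by exact_mod_cast hN.ne') hd)
  · rw [coeff_ramify_eq_zero _ _ _ _ h, coeff_ramify_eq_zero]
    intro hd
    push_cast at hd
    exact h (dvd_of_mul_right_dvd hd)

/-- `f` has a root after adjoining a root of `t`. -/
def HasPuiseuxRoot (f : (LaurentSeries ℂ)[X]) : Prop :=
  ∃ (N : ℕ) (hN : 0 < N) (r : LaurentSeries ℂ), (f.map (ramify N hN)).IsRoot r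

theorem HasPuiseuxRoot.of_dvd {f g : (LaurentSeries ℂ)[X]} (h : HasPuiseuxRoot f) (hd : f ∣ g) :
    HasPuiseuxRoot g := by
  obtain ⟨N, hN, r, hr⟩ := h
  exact ⟨N, hN, r, hr.dvd (Polynomial.map_dvd _ hd)⟩

theorem HasPuiseuxRoot.of_comp {f : (LaurentSeries ℂ)[X]} {a : LaurentSeries ℂ}
    (h : HasPuiseuxRoot (f.comp (X + C a))) : HasPuiseuxRoot f := by
  obtain ⟨N, hN, r, hr⟩ := h
  refine ⟨N, hN, r + ramify N hN a, ?_⟩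
  simpa [IsRoot, Polynomial.map_comp, eval_comp] using hr

theorem HasPuiseuxRoot.of_ramify {f : (LaurentSeries ℂ)[X]} {d : ℕ} {hd : 0 < d}
    (h : HasPuiseuxRoot (f.map (ramify d hd))) : HasPuiseuxRoot f := by
  obtain ⟨N, hN, r, hr⟩ := h
  refine ⟨N * d, Nat.mul_pos hN hd, r, ?_⟩
  have : (ramify N hN).comp (ramify d hd) = ramify (N * d) (Nat.mul_pos hN hd) :=
    RingHom.ext fun x => ramify_comp N d hN hd x
  rwa [Polynomial.map_map, this] at hr

theorem HasPuiseuxRoot.of_scaleRoots {f : (LaurentSeries ℂ)[X]} (hf : f.Monic)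
    {s : LaurentSeries ℂ} (hs : s ≠ 0) (h : HasPuiseuxRoot (f.scaleRoots s)) :
    HasPuiseuxRoot f := by
  obtain ⟨N, hN, r, hr⟩ := h
  refine ⟨N, hN, (ramify N hN s)⁻¹ * r, ?_⟩
  have hs' : ramify N hN s ≠ 0 := by simpa using hs
  rw [map_scaleRoots _ _ _ (by simp [hf])] at hr
  have := scaleRoots_eval₂_mul (p := f.map (ramify N hN)) (RingHom.id _) ((ramify N hN s)⁻¹ * r)
    (ramify N hN s)
  simp only [RingHom.id_apply, ← mul_assoc, mul_inv_cancel₀ hs', one_mul, eval₂_id] at this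
  rw [IsRoot] at hr ⊢
  rw [hr] at this
  exact (mul_eq_zero.1 this.symm).resolve_left (pow_ne_zero _ hs')

theorem coeff_ramify_eq_zero_of_lt {N : ℕ} (hN : 0 < N) {x : LaurentSeries ℂ} {o m : ℤ}
    (ho : ∀ k < o, x.coeff k = 0) (hm : m < N * o) : (ramify N hN x).coeff m = 0 := by
  by_cases h : (N : ℤ) ∣ m
  · obtain ⟨k, rfl⟩ := h
    rw [coeff_ramify_mul]
    exact ho k (lt_of_mul_lt_mul_left hm (by positivity))
  · exact coeff_ramify_eq_zero _ _ _ _ h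

theorem exists_powerSeries_of_coeff_neg {x : LaurentSeries ℂ} (h : ∀ k < 0, x.coeff k = 0) :
    ∃ y : PowerSeries ℂ, HahnSeries.ofPowerSeries ℤ ℂ y = x := by
  refine ⟨PowerSeries.mk fun n => x.coeff n, ?_⟩
  ext k
  rcases lt_or_ge k 0 with hk | hk
  · rw [h k hk, HahnSeries.ofPowerSeries_apply]
    apply HahnSeries.embDomain_of_notMem_range
    rintro ⟨m, hm⟩
    have : (m : ℤ) = k := hm
    omega
  · obtain ⟨n, rfl⟩ := Int.eq_ofNat_of_zero_le hk
    simp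

/-- Taylor expansion, where the `n`-th Hasse derivative is linear. This computes the shift that
removes the subleading coefficient. -/
theorem coeff_comp_X_add_C_of_natDegree {R : Type*} [Field R] {f : R[X]} (hf : f.Monic)
    {n : ℕ} (hn : f.natDegree = n + 1) (a : R) :
    (f.comp (X + C a)).coeff n = f.coeff n + (n + 1) * a := by
  have := taylor_coeff a f n
  rw [taylor_apply] at this
  have hlt : (hasseDeriv n f).natDegree < 2 := by
    have := natDegree_hasseDeriv_le f n
    omega
  have hl : f.coeff (1 + n) = 1 := by rw [add_comm, ← hn, hf.coeff_natDegree]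
  rw [this, eval_eq_sum_range' hlt, Finset.sum_range_succ, Finset.sum_range_one,
    hasseDeriv_coeff, hasseDeriv_coeff, hl]
  simp [add_comm 1 n]

/-- **Newton–Puiseux**: a nonconstant monic polynomial over `ℂ((t))` has a root in
`ℂ((t^(1/N)))` for some `N`. -/
theorem hasPuiseuxRoot_of_monic (n : ℕ) : ∀ f : (LaurentSeries ℂ)[X], f.Monic →
    f.natDegree = n + 1 → HasPuiseuxRoot f := by
  classical
  have : CharZero (LaurentSeries ℂ) :=
    charZero_of_injective_algebraMap (algebraMap ℂ (LaurentSeries ℂ)).injective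
  induction n using Nat.strong_induction_on with
  | _ n ih =>
    -- With vanishing subleading coefficient, a reduction of the form `(X - α) ^ (n + 1)` forces `α
    -- = 0`.
    have key : ∀ f : (LaurentSeries ℂ)[X], f.Monic → f.natDegree = n + 1 → f.coeff n = 0 →
        HasPuiseuxRoot f := by
      intro f hf hn hcn
      by_cases hall : ∀ i ≤ n, f.coeff i = 0
      · refine ⟨1, one_pos, 0, ?_⟩
        rw [IsRoot, ← coeff_zero_eq_eval_zero, coeff_map, hall 0 (Nat.zero_le _), map_zero]
      push Not at hall
      have hne : ((Finset.range (n + 1)).filter fun i => f.coeff i ≠ 0).Nonempty := by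
        obtain ⟨i, hi, hi'⟩ := hall
        exact ⟨i, by simp [hi']; omega⟩
      -- The minimum is the extremal slope of the Newton polygon, attained at `i₀`.
      obtain ⟨i₀, hi₀, hmin⟩ := Finset.exists_min_image _
        (fun i => ((f.coeff i).order : ℚ) / ((n + 1 - i : ℕ) : ℚ)) hne
      simp only [Finset.mem_filter, Finset.mem_range] at hi₀ hmin
      -- The factorial is divisible by every possible denominator `n + 1 - i`, so after `t ↦ t ^ d`
      -- the slope is the integer `e`.
      set d := (n + 1).factorial with hd
      have hdpos : 0 < d := Nat.factorial_pos _
      obtain ⟨c, hc⟩ : (n + 1 - i₀) ∣ d :=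
        Nat.dvd_factorial (by omega) (by omega)
      set e : ℤ := c * (f.coeff i₀).order with he
      have hord : ∀ i < n + 1, f.coeff i ≠ 0 →
          e * ((n + 1 - i : ℕ) : ℤ) ≤ d * (f.coeff i).order := by
        intro i hi hi'
        have h1 := hmin i ⟨hi, hi'⟩
        have hp1 : (0 : ℚ) < ((n + 1 - i : ℕ) : ℚ) := by exact_mod_cast (by omega : 0 < n + 1 - i)
        have hp2 : (0 : ℚ) < ((n + 1 - i₀ : ℕ) : ℚ) := by
          exact_mod_cast (by omega : 0 < n + 1 - i₀)
        rw [div_le_div_iff₀ hp2 hp1] at h1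
        have h2 : (f.coeff i₀).order * ((n + 1 - i : ℕ) : ℤ) ≤
            (f.coeff i).order * ((n + 1 - i₀ : ℕ) : ℤ) := by exact_mod_cast h1
        rw [he, hc]
        push_cast
        calc (c : ℤ) * (f.coeff i₀).order * ((n + 1 - i : ℕ) : ℤ)
            = c * ((f.coeff i₀).order * ((n + 1 - i : ℕ) : ℤ)) := by ring
          _ ≤ c * ((f.coeff i).order * ((n + 1 - i₀ : ℕ) : ℤ)) := by gcongr
          _ = _ := by ring
      have heq : e * ((n + 1 - i₀ : ℕ) : ℤ) = d * (f.coeff i₀).order := by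
        rw [he, hc]; push_cast; ring
      apply HasPuiseuxRoot.of_ramify (hd := hdpos)
      have hfm : (f.map (ramify d hdpos)).Monic := hf.map _
      have hfn : (f.map (ramify d hdpos)).natDegree = n + 1 := by rw [hf.natDegree_map, hn]
      -- Scaling the roots by `t ^ (-e)` makes all coefficients integral and gives the coefficient
      -- at `i₀` a nonzero constant term.
      set s : LaurentSeries ℂ := HahnSeries.single (-e) 1 with hs
      have hs0 : s ≠ 0 := by simp [hs]
      apply HasPuiseuxRoot.of_scaleRoots hfm hs0
      set g := (f.map (ramify d hdpos)).scaleRoots s with hg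
      have hgm : g.Monic := (monic_scaleRoots_iff s).2 hfm
      have hgn : g.natDegree = n + 1 := by rw [hg, natDegree_scaleRoots, hfn]
      have hgc : ∀ i k, (g.coeff i).coeff k =
          (ramify d hdpos (f.coeff i)).coeff (k + e * ((n + 1 - i : ℕ) : ℤ)) := by
        intro i k
        rw [hg, coeff_scaleRoots, hfn, coeff_map, hs, HahnSeries.single_pow, one_pow,
          HahnSeries.coeff_mul_single]
        simp
        ring_nf
      have hneg : ∀ i, ∀ k < 0, (g.coeff i).coeff k = 0 := by
        intro i k hk
        rcases lt_trichotomy i (n + 1) with h | h | h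
        · rw [hgc]
          by_cases hi : f.coeff i = 0
          · simp [hi]
          · refine coeff_ramify_eq_zero_of_lt hdpos
              (fun m hm => HahnSeries.coeff_eq_zero_of_lt_order hm) ?_
            have := hord i h hi
            linarith
        · rw [h, ← hgn, hgm.coeff_natDegree]
          simp [hk.ne]
        · rw [coeff_eq_zero_of_natDegree_lt (by omega)]; simp
      choose b hb using fun i => exists_powerSeries_of_coeff_neg (hneg i)
      have hgl : g ∈ lifts (HahnSeries.ofPowerSeries ℤ ℂ) := by
        rw [lifts_iff_coeff_lifts]
        exact fun i => ⟨b i, hb i⟩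
      obtain ⟨q, hq, hqd, hqm⟩ := lifts_and_natDegree_eq_and_monic hgl hgm
      have hqc : ∀ i, PowerSeries.constantCoeff (q.coeff i) = (g.coeff i).coeff 0 := by
        intro i
        rw [← hq, coeff_map]
        have := HahnSeries.ofPowerSeries_apply_coeff (Γ := ℤ) (q.coeff i) 0
        simpa using this.symm
      have hqn : q.natDegree = n + 1 := hqd.trans hgn
      -- If the reduction were `(X - α) ^ (n + 1)`, its coefficient at `n` would give `α = 0`,
      -- against the nonzero coefficient at `i₀`. A proper factor therefore exists, and the
      -- induction applies to it.
      obtain ⟨f₁, h1, h2, h3, h4⟩ := exists_monic_dvd_of_map_ne_pow hqm (by omega) (by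
        intro α hα
        rw [hqn] at hα
        have hcoeff : (g.coeff n).coeff 0 = 0 := by
          rw [hgc, hcn]; simp
        have hα0 : α = 0 := by
          have h5 := congrArg (fun p : ℂ[X] => p.coeff n) hα
          simp only [coeff_map, hqc, hcoeff] at h5
          rw [sub_eq_add_neg, ← C_neg, coeff_X_add_C_pow] at h5
          have h6 : ((n : ℂ) + 1) ≠ 0 := by exact_mod_cast Nat.succ_ne_zero n
          simpa [h6] using h5
        rw [hα0] at hα
        have h5 := congrArg (fun p : ℂ[X] => p.coeff i₀) hα
        simp only [coeff_map, hqc, hgc, C_0, sub_zero, coeff_X_pow] at h5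
        rw [if_neg (by omega), zero_add, heq, coeff_ramify_mul] at h5
        exact hi₀.2 (HahnSeries.coeff_order_eq_zero.1 h5))
      refine HasPuiseuxRoot.of_dvd (f := f₁.map (HahnSeries.ofPowerSeries ℤ ℂ))
        (ih (f₁.natDegree - 1) (by omega) _ (h1.map _) ?_) ?_
      · rw [h1.natDegree_map]; omega
      · rw [← hq]; exact Polynomial.map_dvd _ h2
    intro f hf hn
    have h6 : ((n : LaurentSeries ℂ) + 1) ≠ 0 := by exact_mod_cast Nat.succ_ne_zero n
    refine HasPuiseuxRoot.of_comp (a := -(f.coeff n / (n + 1)))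
      (key _ (hf.comp_X_add_C _) ?_ ?_)
    · rw [natDegree_comp, natDegree_X_add_C, mul_one, hn]
    · rw [coeff_comp_X_add_C_of_natDegree hf hn]
      field_simp
      ring

/-! ### Series with rational exponents. -/

section HahnTools

variable {R S : Type*}

/-- Allows series whose supports have shrunk to be multiplied over the index set of the original
ones, as the diagonal operators need. -/
theorem coeff_mul_of_support_subset [Semiring R] {x y : HahnSeries ℚ R} {s t : Set ℚ}
    (hs : s.IsPWO) (ht : t.IsPWO) (hx : x.support ⊆ s) (hy : y.support ⊆ t) (q : ℚ) :
    (x * y).coeff q =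
      ∑ ij ∈ Finset.antidiagonal hs ht q, x.coeff ij.1 * y.coeff ij.2 := by
  rw [HahnSeries.coeff_mul]
  refine Finset.sum_subset (fun ij h => ?_) (fun ij h' h => ?_)
  · rw [Finset.mem_antidiagonal] at h ⊢
    exact ⟨hx h.1, hy h.2.1, h.2.2⟩
  · rw [Finset.mem_antidiagonal] at h h'
    by_cases h1 : x.coeff ij.1 = 0
    · rw [h1, zero_mul]
    · by_cases h2 : y.coeff ij.2 = 0
      · rw [h2, mul_zero]
      · exact absurd ⟨h1, h2, h'.2.2⟩ h

/-- The product formula for a series supported on a coset of `ℤ`. -/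
theorem coeff_mul_eq_finsum [Semiring R] {x y : HahnSeries ℚ R} {α : ℚ}
    (hx : ∀ q, x.coeff q ≠ 0 → ∃ k : ℤ, q = α + k) (q : ℚ) :
    (Function.support fun k : ℤ => x.coeff (α + k) * y.coeff (q - (α + k))).Finite ∧
    (x * y).coeff q = ∑ᶠ k : ℤ, x.coeff (α + k) * y.coeff (q - (α + k)) := by
  classical
  set j : ℤ → ℚ × ℚ := fun k => (α + k, q - (α + k)) with hj
  have hinj : Function.Injective j := fun a b h => by simpa [hj] using (Prod.ext_iff.1 h).1
  set F : ℚ × ℚ → R := fun ij => x.coeff ij.1 * y.coeff ij.2 with hF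
  have hsub : (Function.support fun k : ℤ => x.coeff (α + k) * y.coeff (q - (α + k))) ⊆
      (((Finset.antidiagonal x.isPWO_support y.isPWO_support q).preimage j hinj.injOn :
        Finset ℤ) : Set ℤ) := by
    intro k hk
    have hk' : x.coeff (α + k) * y.coeff (q - (α + k)) ≠ 0 := hk
    simp only [Finset.coe_preimage, Set.mem_preimage, Finset.mem_coe,
      Finset.mem_antidiagonal, hj]
    exact ⟨left_ne_zero_of_mul hk', right_ne_zero_of_mul hk', by ring⟩
  refine ⟨Set.Finite.subset (Finset.finite_toSet _) hsub, ?_⟩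
  rw [finsum_eq_sum_of_support_subset _ hsub, HahnSeries.coeff_mul]
  symm
  refine Finset.sum_preimage j _ hinj.injOn F (fun ij hij hr => ?_)
  rw [Finset.mem_antidiagonal] at hij
  obtain ⟨k, hk⟩ := hx _ hij.1
  refine absurd ⟨k, Prod.ext hk.symm ?_⟩ hr
  simp only [hj]
  rw [← hk, ← hij.2.2]; ring

/-- Coefficientwise application of a ring homomorphism. -/
noncomputable def mapCoeff [Semiring R] [Semiring S] (f : R →+* S) :
    HahnSeries ℚ R →+* HahnSeries ℚ S where
  toFun x := x.map f
  map_one' := HahnSeries.map_one f.toMonoidWithZeroHom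
  map_mul' x y := HahnSeries.map_mul (f : R →ₙ+* S)
  map_zero' := by ext; simp
  map_add' x y := by ext; simp

@[simp] theorem coeff_mapCoeff [Semiring R] [Semiring S] (f : R →+* S) (x : HahnSeries ℚ R)
    (q : ℚ) : (mapCoeff f x).coeff q = f (x.coeff q) := rfl

theorem mapCoeff_surjective [Semiring R] [Semiring S] {f : R →+* S} {s : S → R}
    (hs : ∀ c, f (s c) = c) (h0 : s 0 = 0) : Function.Surjective (mapCoeff f) := fun y =>
  ⟨⟨fun q => s (y.coeff q), y.isPWO_support.mono fun q hq h => hq (by simp [h, h0])⟩, by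
    ext q; simp [hs]⟩

/-- Multiplication of the coefficient of `x ^ q` by the scalar `c q`. -/
noncomputable def diagonal [Ring R] [Algebra ℂ R] (c : ℚ → ℂ) (x : HahnSeries ℚ R) :
    HahnSeries ℚ R where
  coeff q := c q • x.coeff q
  isPWO_support' := x.isPWO_support.mono fun q hq h => hq (by simp [h])

@[simp] theorem coeff_diagonal [Ring R] [Algebra ℂ R] (c : ℚ → ℂ) (x : HahnSeries ℚ R) (q : ℚ) :
    (diagonal c x).coeff q = c q • x.coeff q := rfl

theorem support_diagonal_subset [Ring R] [Algebra ℂ R] (c : ℚ → ℂ) (x : HahnSeries ℚ R) :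
    (diagonal c x).support ⊆ x.support := fun q hq h => hq (by simp [h])

theorem diagonal_add [Ring R] [Algebra ℂ R] (c : ℚ → ℂ) (x y : HahnSeries ℚ R) :
    diagonal c (x + y) = diagonal c x + diagonal c y := by
  ext; simp

theorem diagonal_mul [Ring R] [Algebra ℂ R] {c : ℚ → ℂ} (hc : ∀ a b, c (a + b) = c a * c b)
    (x y : HahnSeries ℚ R) : diagonal c (x * y) = diagonal c x * diagonal c y := by
  ext q
  rw [coeff_diagonal, HahnSeries.coeff_mul, coeff_mul_of_support_subset x.isPWO_support
    y.isPWO_support (support_diagonal_subset c x) (support_diagonal_subset c y), Finset.smul_sum]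
  refine Finset.sum_congr rfl fun ij h => ?_
  rw [Finset.mem_antidiagonal] at h
  rw [coeff_diagonal, coeff_diagonal, ← h.2.2, hc, smul_mul_smul_comm]

/-- For `c q = q` the operator is `x d/dx`, which, unlike `d/dx`, keeps exponents in place. -/
theorem diagonal_leibniz [Ring R] [Algebra ℂ R] {c : ℚ → ℂ} (hc : ∀ a b, c (a + b) = c a + c b)
    (x y : HahnSeries ℚ R) : diagonal c (x * y) = x * diagonal c y + diagonal c x * y := by
  ext q
  rw [coeff_diagonal, HahnSeries.coeff_mul, HahnSeries.coeff_add,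
    coeff_mul_of_support_subset x.isPWO_support
    y.isPWO_support subset_rfl (support_diagonal_subset c y),
    coeff_mul_of_support_subset x.isPWO_support
    y.isPWO_support (support_diagonal_subset c x) subset_rfl, Finset.smul_sum,
    ← Finset.sum_add_distrib]
  refine Finset.sum_congr rfl fun ij h => ?_
  rw [Finset.mem_antidiagonal] at h
  rw [coeff_diagonal, coeff_diagonal, ← h.2.2, hc, add_smul, mul_smul_comm, smul_mul_assoc,
    add_comm]

/-- The automorphism `x ^ q ↦ c q • x ^ q` attached to a character `c` of `ℚ`. -/
noncomputable def characterTwist (R : Type*) [Ring R] [Algebra ℂ R] {c : ℚ → ℂ} (h0 : c 0 = 1)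
    (hc : ∀ a b, c (a + b) = c a * c b) : HahnSeries ℚ R →+* HahnSeries ℚ R where
  toFun := diagonal c
  map_one' := by
    ext q
    by_cases h : q = 0 <;> simp [HahnSeries.coeff_one, h, h0]
  map_mul' := diagonal_mul hc
  map_zero' := by ext; simp
  map_add' := diagonal_add c

@[simp] theorem coeff_characterTwist [Ring R] [Algebra ℂ R] {c : ℚ → ℂ} (h0 : c 0 = 1)
    (hc : ∀ a b, c (a + b) = c a * c b) (x : HahnSeries ℚ R) (q : ℚ) :
    (characterTwist R h0 hc x).coeff q = c q • x.coeff q := rfl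

/-- The embedding `t ↦ x ^ (1 / N)` of Laurent series into Hahn series. -/
noncomputable def puiseuxEmb (R : Type*) [Semiring R] (N : ℕ) (hN : 0 < N) :
    LaurentSeries R →+* HahnSeries ℚ R :=
  HahnSeries.embDomainRingHom
    ((AddMonoidHom.mulRight (N : ℚ)⁻¹).comp (Int.castAddHom ℚ))
    (fun a b h => by
      have h' : (a : ℚ) * (N : ℚ)⁻¹ = b * (N : ℚ)⁻¹ := h
      have : ((N : ℚ)⁻¹) ≠ 0 := by positivity
      exact_mod_cast mul_right_cancel₀ this h')
    (fun a b => by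
      have : (0 : ℚ) < (N : ℚ)⁻¹ := by positivity
      change (a : ℚ) * (N : ℚ)⁻¹ ≤ b * (N : ℚ)⁻¹ ↔ _
      rw [mul_le_mul_iff_left₀ this]
      exact_mod_cast Iff.rfl)

theorem coeff_puiseuxEmb_div [Semiring R] (N : ℕ) (hN : 0 < N) (x : LaurentSeries R) (n : ℤ) :
    (puiseuxEmb R N hN x).coeff (n / N) = x.coeff n := by
  rw [div_eq_mul_inv]
  exact HahnSeries.embDomain_mk_coeff (f := fun n : ℤ => (n : ℚ) * (N : ℚ)⁻¹) _ _

theorem coeff_puiseuxEmb_eq_zero [Semiring R] (N : ℕ) (hN : 0 < N) (x : LaurentSeries R) (q : ℚ)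
    (hq : ¬ ∃ n : ℤ, q = n / N) : (puiseuxEmb R N hN x).coeff q = 0 := by
  apply HahnSeries.embDomain_of_notMem_range
  rintro ⟨m, hm⟩
  exact hq ⟨m, by rw [div_eq_mul_inv]; exact hm.symm⟩

theorem puiseuxEmb_injective [Semiring R] (N : ℕ) (hN : 0 < N) :
    Function.Injective (puiseuxEmb R N hN) := by
  intro x y h
  ext n
  rw [← coeff_puiseuxEmb_div N hN x, h, coeff_puiseuxEmb_div]

theorem exists_puiseuxEmb_eq [Semiring R] (N : ℕ) (hN : 0 < N) (x : HahnSeries ℚ R)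
    (hx : ∀ q, x.coeff q ≠ 0 → ∃ n : ℤ, q = n / N) : ∃ y, puiseuxEmb R N hN y = x := by
  have hN' : (0 : ℚ) < N := by exact_mod_cast hN
  refine ⟨⟨fun n => x.coeff (n / N), ?_⟩, ?_⟩
  · intro f
    obtain ⟨m, n, hmn, hle⟩ := x.isPWO_support fun k => ⟨((f k : ℤ) : ℚ) / N, (f k).2⟩
    refine ⟨m, n, hmn, ?_⟩
    change (f m : ℤ) ≤ f n
    have hle' : ((f m : ℤ) : ℚ) / N ≤ (f n : ℤ) / N := hle
    rw [div_le_div_iff_of_pos_right hN'] at hle'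
    exact_mod_cast hle'
  · ext q
    by_cases hq : ∃ n : ℤ, q = n / N
    · obtain ⟨n, rfl⟩ := hq
      rw [coeff_puiseuxEmb_div]
    · rw [coeff_puiseuxEmb_eq_zero _ _ _ _ hq]
      by_contra h
      exact hq (hx q (Ne.symm h))

/-- Both sides send `t` to `x`. Hence all ramification levels sit in one target over the same copy
of the Laurent series. -/
theorem puiseuxEmb_ramify (N : ℕ) (hN : 0 < N) (x : LaurentSeries ℂ) :
    puiseuxEmb ℂ N hN (ramify N hN x) = puiseuxEmb ℂ 1 one_pos x := by
  have hN' : (N : ℚ) ≠ 0 := by exact_mod_cast hN.ne'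
  ext q
  by_cases hq : ∃ n : ℤ, q = n / N
  · obtain ⟨n, rfl⟩ := hq
    rw [coeff_puiseuxEmb_div]
    by_cases hd : (N : ℤ) ∣ n
    · obtain ⟨m, rfl⟩ := hd
      rw [coeff_ramify_mul]
      have h := coeff_puiseuxEmb_div 1 one_pos x m
      rw [← h]
      congr 1
      push_cast
      field_simp
    · rw [coeff_ramify_eq_zero _ _ _ _ hd, coeff_puiseuxEmb_eq_zero]
      rintro ⟨m, hm⟩
      apply hd
      refine ⟨m, ?_⟩
      rw [div_eq_iff hN'] at hm
      have : (n : ℚ) = N * m := by rw [hm]; push_cast; ring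
      exact_mod_cast this
  · rw [coeff_puiseuxEmb_eq_zero _ _ _ _ hq, coeff_puiseuxEmb_eq_zero]
    rintro ⟨m, hm⟩
    refine hq ⟨m * N, ?_⟩
    rw [hm]; push_cast; field_simp

/-- A ring homomorphism into Hahn series with exponents in `(1/N)ℤ` factors through Laurent
series in `x ^ (1 / N)`. -/
theorem exists_laurent_factor {A : Type*} [Semiring A] [Semiring R] (N : ℕ) (hN : 0 < N)
    (T : A →+* HahnSeries ℚ R) (hT : ∀ a q, (T a).coeff q ≠ 0 → ∃ n : ℤ, q = n / N) :
    ∃ T' : A →+* LaurentSeries R, ∀ a, puiseuxEmb R N hN (T' a) = T a := by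
  choose t ht using fun a => exists_puiseuxEmb_eq N hN (T a) (hT a)
  exact ⟨{  toFun := t
            map_one' := puiseuxEmb_injective N hN (by rw [ht, map_one, map_one])
            map_mul' := fun a b => puiseuxEmb_injective N hN (by simp only [ht, map_mul])
            map_zero' := puiseuxEmb_injective N hN (by rw [ht, map_zero, map_zero])
            map_add' := fun a b => puiseuxEmb_injective N hN (by simp only [ht, map_add]) }, ht⟩

end HahnTools

/-! ### Sums over the integers, eigenspaces, and well-ordered exponent sets. -/

/-- Splitting a sum over `ℤ` into its nonnegative and its negative part. -/
theorem finsum_int_eq_finsum_nat {E : Type*} [AddCommMonoid E] {F : ℤ → E}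
    (hF : (Function.support F).Finite) :
    ∑ᶠ k : ℤ, F k = ∑ᶠ i : ℕ, (F i + F (-1 - i)) := by
  have hinj₁ : Function.Injective fun i : ℕ => (i : ℤ) := Nat.cast_injective
  have hinj₂ : Function.Injective fun i : ℕ => (-1 - i : ℤ) := fun a b h => by
    have h' : (-1 - a : ℤ) = -1 - b := h
    omega
  have hdisj : Disjoint (Set.range fun i : ℕ => (i : ℤ)) (Set.range fun i : ℕ => (-1 - i : ℤ)) := by
    rw [Set.disjoint_left]
    rintro _ ⟨a, rfl⟩ ⟨b, hb⟩
    have h' : (-1 - b : ℤ) = a := hb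
    omega
  have huniv : (Set.range fun i : ℕ => (i : ℤ)) ∪ (Set.range fun i : ℕ => (-1 - i : ℤ)) =
      Set.univ := by
    rw [Set.eq_univ_iff_forall]
    intro k
    rcases le_or_gt 0 k with h | h
    · exact Or.inl ⟨k.toNat, by simp [h]⟩
    · refine Or.inr ⟨(-1 - k).toNat, ?_⟩
      change (-1 - ((-1 - k).toNat : ℤ)) = k
      omega
  rw [← finsum_mem_univ, ← huniv,
    finsum_mem_union' hdisj (hF.subset Set.inter_subset_right) (hF.subset Set.inter_subset_right),
    finsum_mem_range hinj₁, finsum_mem_range hinj₂, finsum_add_distrib]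
  · exact hF.preimage hinj₁.injOn
  · exact hF.preimage hinj₂.injOn

/-- Decomposition into eigenvectors of an automorphism of finite order. -/
theorem exists_eigen_decomposition {A : Type*} [CommRing A] [Algebra ℂ A] {ω : ℂ} {p : ℕ}
    (hp : 0 < p) (hω : IsPrimitiveRoot ω p) {g : A ≃ₐ[ℂ] A} (hg : g ^ p = 1) (u : A) :
    ∃ c : ℕ → A, (∀ r, g (c r) = ω ^ r • c r) ∧ u = ∑ r ∈ Finset.range p, c r := by
  have hω0 : ω ≠ 0 := hω.ne_zero hp.ne'
  have hp0 : (p : ℂ) ≠ 0 := by exact_mod_cast hp.ne'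
  -- These are the projectors onto the isotypic parts of the cyclic group generated by `g`; they sum
  -- to the identity by orthogonality of characters.
  refine ⟨fun r => (p : ℂ)⁻¹ • ∑ j ∈ Finset.range p, (ω⁻¹ ^ r) ^ j • (g ^ j) u, ?_, ?_⟩
  · intro r
    have hs : ∀ j, g ((ω⁻¹ ^ r) ^ j • (g ^ j) u) =
        ω ^ r • ((ω⁻¹ ^ r) ^ (j + 1) • (g ^ (j + 1)) u) := by
      intro j
      rw [map_smul, smul_smul, pow_succ' g, AlgEquiv.mul_apply, pow_succ', ← mul_assoc, ← mul_pow,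
        mul_inv_cancel₀ hω0, one_pow, one_mul]
    have hcyc : ∑ j ∈ Finset.range p, (ω⁻¹ ^ r) ^ (j + 1) • (g ^ (j + 1)) u =
        ∑ j ∈ Finset.range p, (ω⁻¹ ^ r) ^ j • (g ^ j) u := by
      have h1 := Finset.sum_range_succ (fun j => (ω⁻¹ ^ r) ^ j • (g ^ j) u) p
      have h2 := Finset.sum_range_succ' (fun j => (ω⁻¹ ^ r) ^ j • (g ^ j) u) p
      have h3 : (ω⁻¹ ^ r) ^ p • (g ^ p) u = (ω⁻¹ ^ r) ^ 0 • (g ^ 0) u := by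
        rw [hg, ← pow_mul, mul_comm r p, pow_mul, inv_pow, hω.pow_eq_one]
        simp
      rw [h1, h3] at h2
      exact (add_right_cancel h2).symm
    change g ((p : ℂ)⁻¹ • ∑ j ∈ Finset.range p, (ω⁻¹ ^ r) ^ j • (g ^ j) u) = _
    rw [map_smul, map_sum, Finset.sum_congr rfl fun j _ => hs j, ← Finset.smul_sum, hcyc,
      smul_comm]
  · have hgeom : ∀ j ∈ Finset.range p, j ≠ 0 → ∑ r ∈ Finset.range p, (ω⁻¹ ^ r) ^ j = 0 := by
      intro j hj hj0
      have hne : ω⁻¹ ^ j - 1 ≠ 0 :=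
        sub_ne_zero.2 (hω.inv.pow_ne_one_of_pos_of_lt hj0 (Finset.mem_range.1 hj))
      have := geom_sum_mul (ω⁻¹ ^ j) p
      rw [← pow_mul, mul_comm j p, pow_mul, hω.inv.pow_eq_one, one_pow, sub_self] at this
      rw [← (mul_eq_zero.1 this).resolve_right hne]
      exact Finset.sum_congr rfl fun r _ => by rw [← pow_mul, ← pow_mul, mul_comm]
    change u = ∑ r ∈ Finset.range p,
      (p : ℂ)⁻¹ • ∑ j ∈ Finset.range p, (ω⁻¹ ^ r) ^ j • (g ^ j) u
    rw [← Finset.smul_sum, Finset.sum_comm]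
    simp_rw [← Finset.sum_smul]
    rw [Finset.sum_eq_single 0 (fun j hj hj0 => by rw [hgeom j hj hj0, zero_smul])
      (fun h => absurd (Finset.mem_range.2 hp) h)]
    simp [smul_smul, hp0]

theorem isPWO_of_bddBelow_of_fraction {p : ℕ} {s : Set ℚ} (hp : 0 < p) (hb : BddBelow s)
    (hs : ∀ q ∈ s, ∃ k : ℤ, q = k / p) : s.IsPWO := by
  have hp' : (0 : ℚ) < p := by exact_mod_cast hp
  obtain ⟨b, hb⟩ := hb
  have hmono : Monotone fun k : ℤ => (k : ℚ) / p := fun a c h => by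
    have : (a : ℚ) ≤ c := by exact_mod_cast h
    change (a : ℚ) / p ≤ c / p
    gcongr
  have hbdd : BddBelow {k : ℤ | b ≤ (k : ℚ) / p} := by
    refine ⟨⌊b * p⌋, fun k hk => ?_⟩
    rw [Set.mem_ofPred_eq, le_div_iff₀ hp'] at hk
    exact_mod_cast (Int.floor_le _).trans hk
  refine ((Set.isPWO_iff_isWF.2 hbdd.wellFoundedOn_lt).image_of_monotone
    hmono).mono ?_
  intro q hq
  obtain ⟨k, rfl⟩ := hs q hq
  exact ⟨k, hb hq, rfl⟩

/-! ### From twisted modules to homomorphisms into series. -/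

section Forward

variable {A M : Type*} [CommRing A] [Algebra ℂ A] [AddCommGroup M] [Module ℂ M]
  {ζ : ℕ → ℂ} {D : Derivation ℂ A A} {g : A ≃ₐ[ℂ] A} {Y : A →ₗ[ℂ] (ℚ → Module.End ℂ M)}

theorem nthProduct_of_nonneg (D : Derivation ℂ A A) {n : ℤ} (hn : 0 ≤ n) (a b : A) :
    nthProduct D n a b = 0 := if_neg (not_lt.2 hn)

theorem nthProduct_neg_one (D : Derivation ℂ A A) (a b : A) :
    nthProduct D (-1) a b = a * b := by simp [nthProduct]

theorem nthProduct_neg_two (D : Derivation ℂ A A) (a b : A) :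
    nthProduct D (-2) a b = D a * b := by simp [nthProduct]

/-- Upper negation; it absorbs the signs of the Jacobi identity for `l = -k - 1`. -/
theorem choose_neg_mul_neg_one_pow (k i : ℕ) :
    ((Ring.choose (-(k : ℤ) - 1) i : ℤ) : ℂ) * (-1) ^ i = ((k + i).choose i : ℕ) := by
  have h : (-(k : ℤ) - 1) = -((k : ℤ) + 1) := by ring
  rw [h, Ring.choose_neg]
  have h2 : ((k : ℤ) + 1 + i - 1) = ((k + i : ℕ) : ℤ) := by push_cast; ring
  rw [h2, Ring.choose_natCast, Units.smul_def, Int.coe_negOnePow_natCast]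
  rw [smul_eq_mul]
  push_cast
  rw [mul_right_comm, ← mul_pow]
  simp

/-- Take `l = 0` in the Jacobi identity: the nonnegative products vanish on the left, and only the
commutator is left on the right. -/
theorem IsTwistedModule.mode_comm (h : IsTwistedModule ζ D g Y)
    (hζ : IsPrimitiveRoot (ζ (orderOf g)) (orderOf g)) (u v : A) (m n : ℚ) :
    Y u m * Y v n = Y v n * Y u m := by
  have key : ∀ r s : ℕ, r < orderOf g → s < orderOf g → ∀ u v : A,
      g u = (ζ (orderOf g)) ^ r • u → g v = (ζ (orderOf g)) ^ s • v →
      Y u m * Y v n = Y v n * Y u m := by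
    intro r s hr hs u v hu hv
    by_cases hm : ∃ k : ℤ, m = (r : ℚ) / (orderOf g : ℚ) + k
    · by_cases hn : ∃ k : ℤ, n = (s : ℚ) / (orderOf g : ℚ) + k
      · ext w
        have hj := h.jacobi r s hr hs u v hu hv m n hm hn 0 w
        rw [finsum_eq_zero_of_forall_eq_zero (fun i => by
          rw [nthProduct_of_nonneg D (by positivity)]; simp)] at hj
        rw [finsum_eq_single _ 0 (fun i hi => by
          rw [Ring.choose_zero_pos ℤ (by omega)]; simp)] at hj
        simp only [Nat.cast_zero, Ring.choose_zero_right, Int.cast_zero, Int.cast_one, pow_zero,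
          sub_zero, zero_add, add_zero, zpow_one, one_mul, one_smul, neg_smul] at hj
        rw [Module.End.mul_apply, Module.End.mul_apply]
        exact (add_neg_eq_zero.1 hj.symm)
      · rw [h.support_eigen s hs v hv n hn]; simp
    · rw [h.support_eigen r hr u hu m hm]; simp
  obtain ⟨c, hc, hu⟩ := exists_eigen_decomposition h.finite_order hζ (pow_orderOf_eq_one g) u
  obtain ⟨d, hd, hv⟩ := exists_eigen_decomposition h.finite_order hζ (pow_orderOf_eq_one g) v
  rw [hu, hv, map_sum, map_sum, Finset.sum_apply, Finset.sum_apply, Finset.sum_mul_sum,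
    Finset.sum_mul_sum, Finset.sum_comm]
  exact Finset.sum_congr rfl fun s hs => Finset.sum_congr rfl fun r hr =>
    key r s (Finset.mem_range.1 hr) (Finset.mem_range.1 hs) _ _ (hc r) (hd s)

/-- Take `l = -2`, `v = 1`, `n = 0`. The right side contains only vacuum modes of index `i ≥ 0` or
`-2 - i`, none of them `-1`, so it vanishes; the left side has the two terms `(D u)_m` and `m
u_{m-1}`. -/
theorem IsTwistedModule.mode_derivation (h : IsTwistedModule ζ D g Y)
    (hζ : IsPrimitiveRoot (ζ (orderOf g)) (orderOf g)) (hgD : ∀ a, g (D a) = D (g a))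
    (u : A) (m : ℚ) : Y (D u) m = -(m : ℂ) • Y u (m - 1) := by
  have key : ∀ r : ℕ, r < orderOf g → ∀ u : A, g u = (ζ (orderOf g)) ^ r • u →
      Y (D u) m = -(m : ℂ) • Y u (m - 1) := by
    intro r hr u hu
    by_cases hm : ∃ k : ℤ, m = (r : ℚ) / (orderOf g : ℚ) + k
    · ext w
      have hj := h.jacobi r 0 hr h.finite_order u 1 hu (by simp) m 0 hm ⟨0, by simp⟩ (-2) w
      rw [finsum_eq_zero_of_forall_eq_zero (f := fun i : ℕ =>
        (((Ring.choose (-2 : ℤ) i : ℤ) : ℂ) * (-1) ^ i) • _) (fun i => by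
          have hi : (0 : ℚ) ≤ i := by positivity
          rw [h.vacuum, h.vacuum, if_neg (by intro h; linarith), if_neg (by
            push_cast
            intro h
            linarith)]
          simp)] at hj
      rw [finsum_eq_sum_of_support_subset (s := {0, 1}) _ (fun i hi => by
        by_contra hi'
        apply hi
        have : 2 ≤ i := by
          simp at hi'
          omega
        simp only
        rw [nthProduct_of_nonneg D (by omega)]; simp)] at hj
      rw [Finset.sum_pair (by simp)] at hj
      have e1 : (-2 + ((1 : ℕ) : ℤ)) = -1 := by norm_num
      have e2 : (-2 + ((0 : ℕ) : ℤ)) = -2 := by norm_num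
      rw [e1, e2, nthProduct_neg_one, nthProduct_neg_two] at hj
      simp only [Ring.choose_zero_right, Ring.choose_one_right, mul_one, add_zero, Nat.cast_zero,
        sub_zero, Nat.cast_one, Rat.cast_one, one_smul] at hj
      rw [LinearMap.smul_apply, neg_smul]
      exact eq_neg_of_add_eq_zero_left hj
    · rw [h.support_eigen r hr u hu (m - 1), h.support_eigen r hr (D u) (by
        rw [hgD, hu, D.map_smul]) m hm, smul_zero]
      rintro ⟨k, hk⟩
      exact hm ⟨k + 1, by push_cast; linarith⟩
  obtain ⟨c, hc, hu⟩ := exists_eigen_decomposition h.finite_order hζ (pow_orderOf_eq_one g) u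
  rw [hu, map_sum, map_sum, map_sum, Finset.sum_apply, Finset.sum_apply, Finset.smul_sum]
  exact Finset.sum_congr rfl fun r hr => key r (Finset.mem_range.1 hr) _ (hc r)

/-- On the `r`-th eigenspace a mode of index `k / p` can be nonzero only if `k ≡ r` modulo `p`, so
the eigenvalue `ζ_p ^ r` equals `ζ_p ^ k`. This expresses the support condition without
eigenvectors. -/
theorem IsTwistedModule.mode_automorphism (h : IsTwistedModule ζ D g Y)
    (hζ : IsPrimitiveRoot (ζ (orderOf g)) (orderOf g)) (u : A) (k : ℤ) :
    Y (g u) (k / orderOf g) = ζ (orderOf g) ^ k • Y u (k / orderOf g) := by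
  have hp : (orderOf g : ℚ) ≠ 0 := by exact_mod_cast h.finite_order.ne'
  have key : ∀ r : ℕ, r < orderOf g → ∀ u : A, g u = (ζ (orderOf g)) ^ r • u →
      Y (g u) (k / orderOf g) = ζ (orderOf g) ^ k • Y u (k / orderOf g) := by
    intro r hr u hu
    rw [hu, map_smul, Pi.smul_apply]
    by_cases hk : ∃ j : ℤ, (k : ℚ) / orderOf g = (r : ℚ) / (orderOf g : ℚ) + j
    · obtain ⟨j, hj⟩ := hk
      have hk : k = r + orderOf g * j := by
        field_simp at hj
        exact_mod_cast hj
      congr 1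
      rw [hk, zpow_add₀ (hζ.ne_zero h.finite_order.ne'), zpow_mul, zpow_natCast, zpow_natCast,
        hζ.pow_eq_one, one_zpow, mul_one]
    · rw [h.support_eigen r hr u hu _ hk, smul_zero, smul_zero]
  obtain ⟨c, hc, hu⟩ := exists_eigen_decomposition h.finite_order hζ (pow_orderOf_eq_one g) u
  rw [hu, map_sum, map_sum, map_sum, Finset.sum_apply, Finset.sum_apply, Finset.smul_sum]
  exact Finset.sum_congr rfl fun r hr => key r (Finset.mem_range.1 hr) _ (hc r)

theorem IsTwistedModule.uniform_truncation [FiniteDimensional ℂ M] (h : IsTwistedModule ζ D g Y)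
    (u : A) : ∃ N : ℚ, ∀ i, N ≤ i → Y u i = 0 := by
  choose N hN using h.truncation u
  let b := Module.finBasis ℂ M
  obtain ⟨B, hB⟩ : BddAbove (Set.range fun j => N (b j)) := (Set.finite_range _).bddAbove
  refine ⟨B, fun i hi => b.ext fun j => ?_⟩
  exact hN _ _ ((hB ⟨j, rfl⟩).trans hi)

theorem IsTwistedModule.exists_linear_series [FiniteDimensional ℂ M]
    (h : IsTwistedModule ζ D g Y) :
    ∃ T : A →ₗ[ℂ] HahnSeries ℚ (Module.End ℂ M), ∀ a q, (T a).coeff q = Y a (-q - 1) := by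
  have hpwo : ∀ a, (Function.support fun q : ℚ => Y a (-q - 1)).IsPWO := by
    intro a
    refine isPWO_of_bddBelow_of_fraction h.finite_order ?_ ?_
    · obtain ⟨N, hN⟩ := h.uniform_truncation a
      refine ⟨-N - 1, fun q hq => ?_⟩
      by_contra hlt
      exact hq (hN _ (by linarith))
    · intro q hq
      by_contra hk
      refine hq (h.support a _ ?_)
      rintro ⟨k, hk'⟩
      refine hk ⟨-k - orderOf g, ?_⟩
      have hp : (orderOf g : ℚ) ≠ 0 := by exact_mod_cast h.finite_order.ne'
      push_cast
      rw [sub_div, neg_div, ← hk', div_self hp]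
      ring
  exact ⟨{  toFun := fun a => ⟨fun q => Y a (-q - 1), hpwo a⟩
            map_add' := fun a b => by ext; simp
            map_smul' := fun c a => by ext; simp }, fun _ _ => rfl⟩

/-- The series `Y(a, x)` of a finite-dimensional twisted module, as an algebra homomorphism. -/
theorem IsTwistedModule.exists_series [FiniteDimensional ℂ M] (h : IsTwistedModule ζ D g Y)
    (hζ : IsPrimitiveRoot (ζ (orderOf g)) (orderOf g)) :
    ∃ T : A →ₐ[ℂ] HahnSeries ℚ (Module.End ℂ M), ∀ a q, (T a).coeff q = Y a (-q - 1) := by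
  obtain ⟨T, hT⟩ := h.exists_linear_series
  have hp : (orderOf g : ℚ) ≠ 0 := by exact_mod_cast h.finite_order.ne'
  have key : ∀ r s : ℕ, r < orderOf g → s < orderOf g → ∀ u v : A,
      g u = (ζ (orderOf g)) ^ r • u → g v = (ζ (orderOf g)) ^ s • v →
      T (u * v) = T u * T v := by
    intro r s hr hs u v hu hv
    ext q : 2
    -- The index `m` lies in the coset of `u`, and `n` is chosen so that `m + n = -q - 1` is the
    -- mode index of `x ^ q`.
    set m : ℚ := r / orderOf g with hm
    set n : ℚ := -q - 1 - m with hn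
    obtain ⟨hfin, hmul⟩ := coeff_mul_eq_finsum (x := T u) (y := T v) (α := -m) (fun q hq => by
      by_contra hk
      rw [hT] at hq
      refine hq (h.support_eigen r hr u hu _ ?_)
      rintro ⟨k, hk'⟩
      exact hk ⟨-k - 1, by push_cast; rw [hm]; linarith⟩) q
    have hterm : ∀ k : ℤ, (T u).coeff (-m + k) * (T v).coeff (q - (-m + k)) =
        Y u (m - 1 - k) * Y v (n + k) := by
      intro k
      rw [hT, hT, hn]
      congr 2 <;> ring_nf
    simp only [hterm] at hfin hmul
    rw [hmul, hT, show -q - 1 = m + n by rw [hn]; ring]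
    -- If `n` lies in the coset of `v`, the Jacobi identity for `l = -1` is the product formula,
    -- with all coefficients equal to `1`. Otherwise both sides vanish for reasons of support.
    by_cases hns : ∃ k : ℤ, n = (s : ℚ) / (orderOf g : ℚ) + k
    · ext w
      have hj := h.jacobi r s hr hs u v hu hv m n ⟨0, by simp [hm]⟩ hns (-1) w
      rw [finsum_eq_single _ 0 (fun i hi => by
        rw [nthProduct_of_nonneg D (by omega)]; simp)] at hj
      simp only [Nat.cast_zero, add_zero, nthProduct_neg_one, Ring.choose_zero_right,
        Rat.cast_one, one_smul, sub_zero] at hj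
      rw [hj, finsum_int_eq_finsum_nat hfin]
      have hfin' : (Function.support fun i : ℕ => Y u (m - 1 - (i : ℤ)) * Y v (n + (i : ℤ)) +
          Y u (m - 1 - ((-1 - i : ℤ) : ℚ)) * Y v (n + ((-1 - i : ℤ) : ℚ))).Finite := by
        refine Set.Finite.subset ((hfin.preimage (f := fun i : ℕ => (i : ℤ))
          Nat.cast_injective.injOn).union (hfin.preimage (f := fun i : ℕ => (-1 - i : ℤ))
            (fun a _ b _ h => by
              have h' : (-1 - a : ℤ) = -1 - b := h
              omega))) (Function.support_add _ _)
      have hev := (LinearMap.applyₗ w : Module.End ℂ M →ₗ[ℂ] M).toAddMonoidHom.map_finsum hfin'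
      refine Eq.trans ?_ hev.symm
      refine finsum_congr fun i => ?_
      have hc := choose_neg_mul_neg_one_pow 0 i
      simp only [Nat.cast_zero, neg_zero, zero_sub, zero_add, Nat.choose_self, Nat.cast_one] at hc
      rw [hc, one_smul]
      simp only [LinearMap.toAddMonoidHom_coe, LinearMap.applyₗ_apply_apply, LinearMap.add_apply]
      rw [h.mode_comm hζ u v (m - 1 - ((-1 - i : ℤ) : ℚ))]
      simp only [Module.End.mul_apply, neg_add_cancel, zpow_zero, one_smul]
      push_cast
      congr 3 <;> ring_nf
    · rw [finsum_eq_zero_of_forall_eq_zero (fun k => by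
        rw [h.support_eigen s hs v hv (n + k), mul_zero]
        rintro ⟨j, hj⟩
        exact hns ⟨j - k, by push_cast; linarith⟩)]
      refine h.support_eigen ((r + s) % orderOf g) (Nat.mod_lt _ h.finite_order) _ ?_ _ ?_
      · rw [map_mul, hu, hv, smul_mul_smul_comm, ← pow_add]
        conv_lhs => rw [← Nat.div_add_mod (r + s) (orderOf g), pow_add, pow_mul, hζ.pow_eq_one,
          one_pow, one_mul]
      · rintro ⟨j, hj⟩
        refine hns ⟨j - ((r + s) / orderOf g : ℕ), ?_⟩
        have hdiv : ((r : ℚ) + s) = orderOf g * ((r + s) / orderOf g : ℕ) +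
            ((r + s) % orderOf g : ℕ) := by
          exact_mod_cast (Nat.div_add_mod (r + s) (orderOf g)).symm
        have : n = ((r + s) % orderOf g : ℕ) / (orderOf g : ℚ) + j - r / orderOf g := by
          rw [← hj, hm]; ring
        rw [this]
        generalize (r + s) / orderOf g = a at hdiv ⊢
        push_cast
        field_simp
        linarith
  refine ⟨AlgHom.ofLinearMap T ?_ ?_, hT⟩
  · ext q : 2
    rw [hT, h.vacuum, HahnSeries.coeff_one]
    by_cases hq : q = 0
    · simp [hq]; rfl
    · rw [if_neg hq, if_neg (fun h => hq (by linarith))]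
  · intro u v
    obtain ⟨c, hc, hu⟩ := exists_eigen_decomposition h.finite_order hζ (pow_orderOf_eq_one g) u
    obtain ⟨d, hd, hv⟩ := exists_eigen_decomposition h.finite_order hζ (pow_orderOf_eq_one g) v
    rw [hu, hv, Finset.sum_mul_sum, map_sum, map_sum, map_sum, Finset.sum_mul_sum]
    refine Finset.sum_congr rfl fun r hr => ?_
    rw [map_sum]
    exact Finset.sum_congr rfl fun s hs =>
      key r s (Finset.mem_range.1 hr) (Finset.mem_range.1 hs) _ _ (hc r) (hd s)

end Forward

/-! ### From homomorphisms into series back to twisted modules. -/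

theorem succ_mul_ringChoose_succ (x : ℚ) (j : ℕ) :
    ((j : ℚ) + 1) * Ring.choose x (j + 1) = Ring.choose x j * (x - j) := by
  rw [Ring.choose_eq_smul, Ring.choose_eq_smul, descPochhammer_succ_right]
  simp only [smeval_mul, smeval_sub, smeval_X, smeval_natCast, smul_eq_mul]
  have h : ((j.factorial : ℕ) : ℚ) ≠ 0 := by exact_mod_cast j.factorial_ne_zero
  have h' : ((j : ℚ) + 1) ≠ 0 := by positivity
  rw [Nat.factorial_succ]
  push_cast
  field_simp
  simp

section Converse

variable {A M : Type*} [CommRing A] [Algebra ℂ A] [AddCommGroup M] [Module ℂ M]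
  {D : Derivation ℂ A A} {T : A →ₐ[ℂ] HahnSeries ℚ (Module.End ℂ M)}

/-- The `j`-fold derivative of `x ^ (q + j)`, with its falling factorial written as `j!` times a
binomial coefficient. -/
theorem coeff_iterate_derivation
    (hD : ∀ u q, (T (D u)).coeff q = ((q + 1 : ℚ) : ℂ) • (T u).coeff (q + 1)) (u : A) (j : ℕ) :
    ∀ q : ℚ, (T (D^[j] u)).coeff q =
      ((j.factorial * Ring.choose (q + j) j : ℚ) : ℂ) • (T u).coeff (q + j) := by
  induction j with
  | zero => intro q; simp
  | succ j ih =>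
    intro q
    rw [Function.iterate_succ_apply', hD, ih, smul_smul, ← Rat.cast_mul]
    have e : q + 1 + (j : ℚ) = q + ((j + 1 : ℕ) : ℚ) := by push_cast; ring
    have h := succ_mul_ringChoose_succ (q + ((j + 1 : ℕ) : ℚ)) j
    rw [e, Nat.factorial_succ]
    congr 2
    have e2 : q + ((j + 1 : ℕ) : ℚ) - j = q + 1 := by push_cast; ring
    rw [e2] at h
    push_cast at h ⊢
    linear_combination (-(j.factorial : ℚ)) * h

/-- The Jacobi identity with nonnegative `l` for commuting modes. -/
theorem alternating_mode_sum_eq_zero {U V : ℚ → Module.End ℂ M}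
    (hcomm : ∀ i j, U i * V j = V j * U i) (m n : ℚ) (l : ℕ) (w : M) :
    ∑ᶠ i : ℕ, (((Ring.choose (l : ℤ) i : ℤ) : ℂ) * (-1) ^ i) •
        (U (((l : ℤ) : ℚ) + m - i) (V (n + i) w) +
          ((-1 : ℂ) ^ ((l : ℤ) + 1)) • V (((l : ℤ) : ℚ) + n - i) (U (m + i) w)) = 0 := by
  set a : ℕ → M := fun i => ((l.choose i : ℂ) * (-1) ^ i) • U ((l : ℚ) + m - i) (V (n + i) w)
    with ha
  -- Once the operators are commuted past each other, the second half of the sum is the first half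
  -- reversed by `i ↦ l - i`, with opposite sign.
  have hs : ∀ i ∈ Finset.range (l + 1), (((Ring.choose (l : ℤ) i : ℤ) : ℂ) * (-1) ^ i) •
        (U (((l : ℤ) : ℚ) + m - i) (V (n + i) w) +
          ((-1 : ℂ) ^ ((l : ℤ) + 1)) • V (((l : ℤ) : ℚ) + n - i) (U (m + i) w)) =
      a i - a (l + 1 - 1 - i) := by
    intro i hi
    have hi' : i ≤ l := by simpa [Nat.lt_succ_iff] using hi
    have hVU : V ((l : ℚ) + n - i) (U (m + i) w) = U (m + i) (V ((l : ℚ) + n - i) w) := by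
      rw [← Module.End.mul_apply, ← hcomm, Module.End.mul_apply]
    have hpow : (-1 : ℂ) ^ (l - i) = (-1) ^ l * (-1) ^ i := by
      conv_rhs => rw [← Nat.sub_add_cancel hi', pow_add, mul_assoc, ← mul_pow]
      simp
    rw [Ring.choose_natCast, ha]
    simp only [add_tsub_cancel_right, Int.cast_natCast]
    rw [hVU, Nat.choose_symm hi', hpow, Nat.cast_sub hi',
      show (l : ℚ) + m - ((l : ℚ) - i) = m + i by ring,
      show n + ((l : ℚ) - i) = l + n - i by ring, smul_add, smul_smul,
      sub_eq_add_neg (_ : M) _, ← neg_smul]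
    congr 2
    rw [zpow_add₀ (by norm_num), zpow_natCast]
    simp only [zpow_one]
    ring
  rw [finsum_eq_sum_of_support_subset (s := Finset.range (l + 1)) _ (fun i hi => by
    by_contra hi'
    apply hi
    have : l < i := by simpa using hi'
    simp only
    rw [Ring.choose_natCast, Nat.choose_eq_zero_of_lt this]
    simp), Finset.sum_congr rfl hs, Finset.sum_sub_distrib, Finset.sum_range_reflect, sub_self]

/-- The coefficient identity behind the Jacobi identity with negative `l`. -/
theorem negative_mode_sum {F : ℤ → M} (hF : (Function.support F).Finite) (m : ℚ) (k₀ : ℕ) :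
    ∑ i ∈ Finset.range (k₀ + 1), ((Ring.choose m i : ℚ) : ℂ) •
        ∑ᶠ k : ℤ, ((Ring.choose ((k : ℚ) - m) (k₀ - i) : ℚ) : ℂ) • F k =
      ∑ᶠ i : ℕ, (((Ring.choose (-(k₀ : ℤ) - 1) i : ℤ) : ℂ) * (-1) ^ i) •
        (F (k₀ + i) + ((-1 : ℂ) ^ (-(k₀ : ℤ))) • F (-1 - i)) := by
  -- Both sides equal `∑ C(k, k₀) F k`. On the left this is Vandermonde for `k = m + (k - m)`. On
  -- the right, `C(k, k₀)` vanishes for `0 ≤ k < k₀` and upper negation treats `k < 0`.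
  set G : ℤ → M := fun k => ((Ring.choose (k : ℤ) k₀ : ℤ) : ℂ) • F k with hG
  have hfin : (Function.support G).Finite := hF.subset fun k hk h => hk (by simp [hG, h])
  have hleft : ∑ i ∈ Finset.range (k₀ + 1), ((Ring.choose m i : ℚ) : ℂ) •
        ∑ᶠ k : ℤ, ((Ring.choose ((k : ℚ) - m) (k₀ - i) : ℚ) : ℂ) • F k = ∑ᶠ k : ℤ, G k := by
    have hsub : ∀ c : ℤ → ℂ, (Function.support fun k => c k • F k) ⊆ (hF.toFinset : Set ℤ) :=
      fun c k hk => by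
        rw [Set.Finite.coe_toFinset]
        exact fun h => hk (by simp [h])
    rw [finsum_eq_sum_of_support_subset _ (hsub _)]
    simp_rw [finsum_eq_sum_of_support_subset _ (hsub _), Finset.smul_sum, smul_smul]
    rw [Finset.sum_comm]
    refine Finset.sum_congr rfl fun k _ => ?_
    rw [← Finset.sum_smul]
    congr 1
    have hv := Ring.add_choose_eq (r := m) (s := (k : ℚ) - m) k₀ (Commute.all _ _)
    rw [add_sub_cancel, Finset.Nat.sum_antidiagonal_eq_sum_range_succ_mk] at hv
    have hcast : ((Ring.choose k k₀ : ℤ) : ℚ) = Ring.choose (k : ℚ) k₀ :=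
      Ring.map_choose (Int.castRingHom ℚ) k k₀
    have := congrArg (fun x : ℚ => (x : ℂ)) (hcast.trans hv)
    push_cast at this
    exact this.symm
  have hnat : ∑ᶠ i : ℕ, G i = ∑ᶠ i : ℕ, G (k₀ + i) := by
    have hinj : Function.Injective fun i : ℕ => (k₀ + i : ℕ) := add_right_injective k₀
    have h := finsum_mem_range (f := fun j : ℕ => G j) hinj
    simp only [Nat.cast_add] at h
    rw [← h, ← finsum_mem_univ]
    refine finsum_mem_inter_support_eq _ _ _ (Set.ext fun j => ?_)
    simp only [Set.mem_inter_iff, Set.mem_univ, true_and, iff_and_self]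
    intro hj
    refine ⟨j - k₀, Nat.add_sub_cancel' ?_⟩
    by_contra hlt
    apply hj
    simp only [hG]
    rw [Ring.choose_natCast, Nat.choose_eq_zero_of_lt (by omega)]
    simp
  have hG1 : ∀ i : ℕ, G (k₀ + i) =
      (((Ring.choose (-(k₀ : ℤ) - 1) i : ℤ) : ℂ) * (-1) ^ i) • F (k₀ + i) := by
    intro i
    rw [choose_neg_mul_neg_one_pow]
    simp only [hG]
    rw [← Nat.cast_add, Ring.choose_natCast, Nat.choose_symm_add]
    simp
  have hG2 : ∀ i : ℕ, G (-1 - i) =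
      (((Ring.choose (-(k₀ : ℤ) - 1) i : ℤ) : ℂ) * (-1) ^ i) •
        (((-1 : ℂ) ^ (-(k₀ : ℤ))) • F (-1 - i)) := by
    intro i
    rw [choose_neg_mul_neg_one_pow, smul_smul]
    simp only [hG]
    congr 1
    have h := choose_neg_mul_neg_one_pow i k₀
    rw [show (-1 - i : ℤ) = -(i : ℤ) - 1 by ring, add_comm k₀ i, Nat.choose_symm_add, ← h,
      mul_assoc, zpow_neg, zpow_natCast, mul_inv_cancel₀ (pow_ne_zero _ (by norm_num)), mul_one]
  rw [hleft, finsum_int_eq_finsum_nat hfin, finsum_add_distrib, hnat, ← finsum_add_distrib]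
  · refine finsum_congr fun i => ?_
    rw [hG1, smul_add, ← hG2]
  · exact hfin.preimage (f := fun i : ℕ => (k₀ + i : ℤ)) fun a _ b _ h => by
      have h' : (k₀ + a : ℤ) = k₀ + b := h
      omega
  · exact hfin.preimage (f := fun i : ℕ => (-1 - i : ℤ)) fun a _ b _ h => by
      have h' : (-1 - a : ℤ) = -1 - b := h
      omega
  · exact hfin.preimage (f := fun i : ℕ => (i : ℤ)) Nat.cast_injective.injOn
  · exact hfin.preimage (f := fun i : ℕ => (-1 - i : ℤ)) fun a _ b _ h => by
      have h' : (-1 - a : ℤ) = -1 - b := h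
      omega

/-- A commuting algebra homomorphism into Hahn series which intertwines `D` with `d/dx` and has
the right exponents on eigenvectors defines a twisted module. -/
theorem isTwistedModule_of_series {ζ : ℕ → ℂ} {g : A ≃ₐ[ℂ] A}
    {Y : A →ₗ[ℂ] (ℚ → Module.End ℂ M)} (hp : 0 < orderOf g)
    (hζ : IsPrimitiveRoot (ζ (orderOf g)) (orderOf g))
    (hY : ∀ u i, Y u i = (T u).coeff (-i - 1))
    (hcomm : ∀ u v i j, Y u i * Y v j = Y v j * Y u i)
    (hD : ∀ u q, (T (D u)).coeff q = ((q + 1 : ℚ) : ℂ) • (T u).coeff (q + 1))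
    (hsupp : ∀ r : ℕ, r < orderOf g → ∀ u, g u = ζ (orderOf g) ^ r • u →
      ∀ i, Y u i ≠ 0 → ∃ k : ℤ, i = r / orderOf g + k) :
    IsTwistedModule ζ D g Y where
  finite_order := hp
  support u i hi := by
    have hp' : (orderOf g : ℚ) ≠ 0 := by exact_mod_cast hp.ne'
    obtain ⟨c, hc, hu⟩ := exists_eigen_decomposition hp hζ (pow_orderOf_eq_one g) u
    rw [hu, map_sum, Finset.sum_apply]
    refine Finset.sum_eq_zero fun r hr => ?_
    by_contra h
    obtain ⟨k, hk⟩ := hsupp r (Finset.mem_range.1 hr) _ (hc r) i h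
    refine hi ⟨r + k * orderOf g, ?_⟩
    rw [hk]; push_cast; field_simp
  support_eigen r hr u hu i hi := by
    by_contra h
    exact hi (hsupp r hr u hu i h)
  truncation u w := by
    refine ⟨-(T u).order, fun i hi => ?_⟩
    rw [hY, HahnSeries.coeff_eq_zero_of_lt_order (by linarith), LinearMap.zero_apply]
  vacuum i := by
    rw [hY, map_one, HahnSeries.coeff_one]
    by_cases hi : i = -1
    · simp [hi]; rfl
    · rw [if_neg hi, if_neg fun h => hi (by linarith)]
  jacobi r s hr hs u v hu hv m n hm hn l w := by
    rcases le_or_gt 0 l with hl | hl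
    · obtain ⟨l, rfl⟩ := Int.eq_ofNat_of_zero_le hl
      rw [finsum_eq_zero_of_forall_eq_zero (fun i => by
        rw [nthProduct_of_nonneg D (by positivity)]; simp)]
      exact (alternating_mode_sum_eq_zero (hcomm u v) m n l w).symm
    obtain ⟨k₀, rfl⟩ : ∃ k₀ : ℕ, l = -(k₀ : ℤ) - 1 := ⟨(-l - 1).toNat, by omega⟩
    have hclass : ∀ α : ℚ, (∃ j : ℤ, α = -m + j) → ∀ q, (T u).coeff q ≠ 0 →
        ∃ k : ℤ, q = α + k := by
      rintro α ⟨j, rfl⟩ q hq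
      have := hsupp r hr u hu (-q - 1) (by rw [hY]; simpa using hq)
      obtain ⟨k, hk⟩ := this
      obtain ⟨k', hk'⟩ := hm
      exact ⟨-j - k + k' - 1, by push_cast; linarith⟩
    -- Every term of the identity is a combination of these products, whose two indices have the
    -- constant sum `m + n - 1 - k₀`; `k - m` is the exponent of `x` in the factor from `u`.
    set E : ℤ → Module.End ℂ M := fun k => Y u (m - 1 - k) * Y v (n - k₀ + k) with hE
    have hEfin : (Function.support E).Finite := by
      obtain ⟨hfin, -⟩ := coeff_mul_eq_finsum (x := T u) (y := T v) (α := -m)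
        (hclass _ ⟨0, by simp⟩) (k₀ - n - 1 - m)
      refine hfin.subset fun k hk => ?_
      have hk' : E k ≠ 0 := hk
      rw [Function.mem_support]
      convert hk' using 1
      simp only [hE, hY]
      congr 2 <;> ring
    have hFfin : (Function.support fun k => E k w).Finite :=
      hEfin.subset fun k hk h => hk (by simp [h])
    have hterm : ∀ i ≤ k₀, Y (nthProduct D (-(k₀ : ℤ) - 1 + i) u v) (m + n - i) w =
        ∑ᶠ k : ℤ, ((Ring.choose ((k : ℚ) - m) (k₀ - i) : ℚ) : ℂ) • E k w := by
      intro i hi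
      obtain ⟨j, rfl⟩ := Nat.exists_eq_add_of_le' hi
      have hsub : j + i - i = j := by omega
      have hprod : nthProduct D (-((j + i : ℕ) : ℤ) - 1 + i) u v =
          ((j.factorial : ℂ)⁻¹) • (D^[j] u * v) := by
        have h1 : (-((j + i : ℕ) : ℤ) - 1 + i) < 0 := by push_cast; omega
        have h2 : (-(-((j + i : ℕ) : ℤ) - 1 + i) - 1).toNat = j := by push_cast; omega
        rw [nthProduct, if_pos h1, h2]
      have hj0 : (j.factorial : ℂ) ≠ 0 := by exact_mod_cast j.factorial_ne_zero
      rw [hsub, hprod, map_smul, Pi.smul_apply, hY, map_mul]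
      obtain ⟨-, hmul⟩ := coeff_mul_eq_finsum (x := T (D^[j] u)) (y := T v) (α := -m - j)
        (fun q hq => by
          rw [coeff_iterate_derivation hD] at hq
          obtain ⟨k, hk⟩ := hclass (-m) ⟨0, by simp⟩ (q + j) (right_ne_zero_of_smul hq)
          exact ⟨k, by linarith⟩) (-(m + n - i) - 1)
      have hEk : ∀ k : ℤ, (T (D^[j] u)).coeff (-m - j + k) *
          (T v).coeff (-(m + n - i) - 1 - (-m - j + k)) =
          ((j.factorial * Ring.choose ((k : ℚ) - m) j : ℚ) : ℂ) • E k := by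
        intro k
        rw [coeff_iterate_derivation hD, smul_mul_assoc, hE]
        simp only [hY]
        push_cast
        congr 3 <;> ring_nf
      simp only [hEk] at hmul
      rw [hmul]
      have hfin2 : (Function.support fun k : ℤ =>
          ((j.factorial * Ring.choose ((k : ℚ) - m) j : ℚ) : ℂ) • E k).Finite :=
        hEfin.subset fun k hk h => hk (by simp [h])
      have hev := ((j.factorial : ℂ)⁻¹ •
        (LinearMap.applyₗ w : Module.End ℂ M →ₗ[ℂ] M)).toAddMonoidHom.map_finsum hfin2
      refine Eq.trans hev (finsum_congr fun k => ?_)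
      simp only [LinearMap.toAddMonoidHom_coe, LinearMap.smul_apply,
        LinearMap.applyₗ_apply_apply, smul_smul]
      congr 1
      push_cast
      field_simp
    -- For `i > k₀` the product index `-k₀ - 1 + i` is nonnegative, so the product is zero.
    rw [finsum_eq_sum_of_support_subset (s := Finset.range (k₀ + 1)) _ (fun i hi => by
      by_contra hi'
      apply hi
      have : k₀ < i := by simpa using hi'
      simp only
      rw [nthProduct_of_nonneg D (by omega)]
      simp), Finset.sum_congr rfl fun i hi => by
        rw [hterm i (Nat.lt_succ_iff.1 (Finset.mem_range.1 hi))], negative_mode_sum hFfin]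
    refine finsum_congr fun i => ?_
    rw [show -(k₀ : ℤ) - 1 + 1 = -(k₀ : ℤ) by ring]
    have e2 : E (-1 - i) = Y v (((-(k₀ : ℤ) - 1 : ℤ) : ℚ) + n - i) * Y u (m + i) := by
      rw [← hcomm, hE]
      push_cast
      ring_nf
    have e1 : E (k₀ + i) = Y u (((-(k₀ : ℤ) - 1 : ℤ) : ℚ) + m - i) * Y v (n + i) := by
      rw [hE]
      push_cast
      ring_nf
    rw [e1, e2]
    rfl

end Converse

/-! ### Lifting field embeddings along nilpotent ideals. -/

section Lifting

variable {F K B : Type*} [Field F] [Field K] [Algebra F K] [CommRing B]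

/-- Series with coefficients in an ideal. -/
def coeffIdeal (J : Ideal B) : Ideal (HahnSeries ℚ B) where
  carrier := {x | ∀ q, x.coeff q ∈ J}
  add_mem' hx hy q := J.add_mem (hx q) (hy q)
  zero_mem' _ := J.zero_mem
  smul_mem' c x hx q := by
    rw [smul_eq_mul, HahnSeries.coeff_mul]
    exact J.sum_mem fun ij _ => J.mul_mem_left _ (hx _)

theorem coeffIdeal_pow_le (J : Ideal B) (n : ℕ) : coeffIdeal J ^ n ≤ coeffIdeal (J ^ n) := by
  induction n with
  | zero => intro x _ q; simp
  | succ n ih =>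
    rw [pow_succ, Ideal.mul_le]
    intro x hx y hy q
    rw [HahnSeries.coeff_mul, pow_succ]
    exact Ideal.sum_mem _ fun ij _ => Ideal.mul_mem_mul (ih hx _) (hy _)

/-- Nilpotency of the ideal, not just of its elements, is needed: a series has infinitely many
coefficients, and one exponent must serve them all. -/
theorem isNilpotent_ker_mapCoeff {χ : B →+* ℂ} (h : IsNilpotent (RingHom.ker χ)) :
    IsNilpotent (RingHom.ker (mapCoeff χ)) := by
  obtain ⟨n, hn⟩ := h
  have hle : RingHom.ker (mapCoeff χ) ≤ coeffIdeal (RingHom.ker χ) := fun x hx q => by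
    rw [RingHom.mem_ker] at hx ⊢
    rw [← coeff_mapCoeff, hx, HahnSeries.coeff_zero]
  refine ⟨n, ?_⟩
  rw [Ideal.zero_eq_bot, eq_bot_iff]
  intro x hx
  have := coeffIdeal_pow_le _ n (Ideal.pow_right_mono hle n hx)
  rw [hn] at this
  rw [Ideal.mem_bot]
  ext q
  simpa using this q

/-- A separable extension is formally étale, hence formally smooth, and reduction of coefficients is
surjective with nilpotent kernel. -/
theorem exists_lift_of_residue [Algebra.IsSeparable F K] [Algebra ℂ B] {χ : B →ₐ[ℂ] ℂ}
    (hχ : IsNilpotent (RingHom.ker (χ : B →+* ℂ))) (y : F →+* HahnSeries ℚ B)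
    (φ : K →+* HahnSeries ℚ ℂ)
    (h : ∀ a, φ (algebraMap F K a) = mapCoeff (χ : B →+* ℂ) (y a)) :
    ∃ T : K →+* HahnSeries ℚ B, (∀ a, T (algebraMap F K a) = y a) ∧
      ∀ a, mapCoeff (χ : B →+* ℂ) (T a) = φ a := by
  have : Algebra.FormallyEtale F K := Algebra.FormallyEtale.of_isSeparable F K
  let : Algebra F (HahnSeries ℚ B) := y.toAlgebra
  let : Algebra F (HahnSeries ℚ ℂ) := (φ.comp (algebraMap F K)).toAlgebra
  let f : K →ₐ[F] HahnSeries ℚ ℂ := { φ with commutes' := fun a => rfl }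
  let p : HahnSeries ℚ B →ₐ[F] HahnSeries ℚ ℂ :=
    { mapCoeff (χ : B →+* ℂ) with commutes' := fun a => (h a).symm }
  have hp : Function.Surjective p :=
    mapCoeff_surjective (s := algebraMap ℂ B) (fun c => χ.commutes c) (map_zero _)
  have hn : IsNilpotent (RingHom.ker (p : HahnSeries ℚ B →+* HahnSeries ℚ ℂ)) :=
    isNilpotent_ker_mapCoeff hχ
  let T := Algebra.FormallySmooth.liftOfSurjective f p hp hn
  exact ⟨T, fun a => T.commutes a,
    fun a => Algebra.FormallySmooth.liftOfSurjective_apply f p hp hn a⟩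

/-- The uniqueness half: a separable extension is formally unramified. -/
theorem lift_eq_of_residue_eq [Algebra.IsSeparable F K] {χ : B →+* ℂ}
    (hχ : IsNilpotent (RingHom.ker χ)) {T₁ T₂ : K →+* HahnSeries ℚ B}
    (hF : ∀ a, T₁ (algebraMap F K a) = T₂ (algebraMap F K a))
    (hres : ∀ a, mapCoeff χ (T₁ a) = mapCoeff χ (T₂ a)) : T₁ = T₂ := by
  have : Algebra.FormallyUnramified F K := Algebra.FormallyUnramified.of_isSeparable F K
  let : Algebra F (HahnSeries ℚ B) := (T₁.comp (algebraMap F K)).toAlgebra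
  let f₁ : K →ₐ[F] HahnSeries ℚ B := { T₁ with commutes' := fun a => rfl }
  let f₂ : K →ₐ[F] HahnSeries ℚ B := { T₂ with commutes' := fun a => (hF a).symm }
  have := Algebra.FormallyUnramified.lift_unique_of_ringHom (mapCoeff χ)
    (isNilpotent_ker_mapCoeff hχ) f₁ f₂ (RingHom.ext hres)
  exact RingHom.ext fun a => DFunLike.congr_fun this a

/-- Vanishing on `F` makes `δ` an `F`-linear derivation, and separability makes the Kähler
differentials of `K / F` zero. -/
theorem eq_zero_of_leibniz [Algebra.IsSeparable F K] (T : K →+* B) (δ : K →+ B)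
    (hδ : ∀ a b, δ (a * b) = T a * δ b + T b * δ a)
    (h0 : ∀ a, δ (algebraMap F K a) = 0) (a : K) : δ a = 0 := by
  have : Algebra.FormallyUnramified F K := Algebra.FormallyUnramified.of_isSeparable F K
  let : Algebra K B := T.toAlgebra
  let : Algebra F B := (T.comp (algebraMap F K)).toAlgebra
  have : IsScalarTower F K B := IsScalarTower.of_algebraMap_eq fun _ => rfl
  let d : Derivation F K B := Derivation.mk'
    { toFun := δ
      map_add' := map_add δ
      map_smul' := fun c a => by
        rw [Algebra.smul_def, hδ, h0, mul_zero, add_zero, Algebra.smul_def]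
        rfl }
    (fun a b => by
      rw [Algebra.smul_def, Algebra.smul_def]
      exact hδ a b)
  have hs : Subsingleton (Derivation F K B) :=
    (KaehlerDifferential.linearMapEquivDerivation F K).symm.injective.subsingleton
  exact DFunLike.congr_fun (Subsingleton.elim d 0) a

/-- A primitive element is sent to a Puiseux root of its minimal polynomial. -/
theorem exists_extension_of_laurent [FiniteDimensional F K] [Algebra.IsSeparable F K]
    (φ : F →+* LaurentSeries ℂ) :
    ∃ ψ : K →+* HahnSeries ℚ ℂ, ∀ a, ψ (algebraMap F K a) = puiseuxEmb ℂ 1 one_pos (φ a) := by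
  let pb := Field.powerBasisOfFiniteOfSeparable F K
  have hint : IsIntegral F pb.gen := Algebra.IsIntegral.isIntegral _
  have hm : (minpoly F pb.gen).Monic := minpoly.monic hint
  have hpos : 0 < (minpoly F pb.gen).natDegree := minpoly.natDegree_pos hint
  obtain ⟨N, hN, r, hr⟩ := hasPuiseuxRoot_of_monic ((minpoly F pb.gen).natDegree - 1)
    ((minpoly F pb.gen).map φ) (hm.map φ) (by rw [hm.natDegree_map]; omega)
  let : Algebra F (HahnSeries ℚ ℂ) := ((puiseuxEmb ℂ 1 one_pos).comp φ).toAlgebra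
  have hroot : aeval (puiseuxEmb ℂ N hN r) (minpoly F pb.gen) = 0 := by
    have h1 : (puiseuxEmb ℂ 1 one_pos).comp φ =
        ((puiseuxEmb ℂ N hN).comp (ramify N hN)).comp φ :=
      RingHom.ext fun a => (puiseuxEmb_ramify N hN (φ a)).symm
    rw [aeval_def]
    change eval₂ ((puiseuxEmb ℂ 1 one_pos).comp φ) _ _ = 0
    rw [h1, RingHom.comp_assoc, ← hom_eval₂, ← eval₂_map, ← eval_map]
    rw [IsRoot] at hr
    rw [hr, map_zero]
  exact ⟨pb.lift _ hroot, fun a => (pb.lift _ hroot).commutes a⟩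

end Lifting

/-! ### Galois theory of `K / K^G`. -/

/-- Two embeddings of a normal extension which agree on the base differ by an automorphism. -/
theorem exists_algEquiv_of_agree {F K L : Type*} [Field F] [Field K] [Algebra F K] [Normal F K]
    [Field L] {φ₁ φ₂ : K →+* L} (h : ∀ a, φ₁ (algebraMap F K a) = φ₂ (algebraMap F K a)) :
    ∃ e : K ≃ₐ[F] K, ∀ a, φ₂ a = φ₁ (e a) := by
  let : Algebra K L := φ₁.toAlgebra
  let : Algebra F L := (φ₁.comp (algebraMap F K)).toAlgebra
  have : IsScalarTower F K L := IsScalarTower.of_algebraMap_eq fun _ => rfl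
  let f : K →ₐ[F] L := { φ₂ with commutes' := fun a => (h a).symm }
  refine ⟨Normal.algHomEquivAut F L K f, fun a => ?_⟩
  have h2 : (Normal.algHomEquivAut F L K).symm (Normal.algHomEquivAut F L K f) a = f a := by
    rw [Equiv.symm_apply_apply]
  exact h2.symm

theorem isGaloisGroup_fixedField {K : Type*} [Field K] [Algebra ℂ K]
    (G : Subgroup (K ≃ₐ[ℂ] K)) [Finite G] :
    IsGaloisGroup G (IntermediateField.fixedField G) K :=
  inferInstanceAs (IsGaloisGroup G (FixedPoints.subfield G K) K)

/-- Two embeddings of `K` which agree on `K^G` differ by an element of `G`. -/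
theorem exists_mem_of_agree_on_fixedField {K L : Type*} [Field K] [Algebra ℂ K] [Field L]
    (G : Subgroup (K ≃ₐ[ℂ] K)) [Finite G] {φ₁ φ₂ : K →+* L}
    (h : ∀ a : IntermediateField.fixedField G, φ₁ a = φ₂ a) :
    ∃ σ ∈ G, ∀ a, φ₂ a = φ₁ (σ a) := by
  have hgal := isGaloisGroup_fixedField G
  have : IsGalois (IntermediateField.fixedField G) K := IsGaloisGroup.isGalois G _ K
  obtain ⟨e, he⟩ := exists_algEquiv_of_agree (F := IntermediateField.fixedField G) h
  let σ := (IsGaloisGroup.mulEquivAlgEquiv G (IntermediateField.fixedField G) K).symm e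
  refine ⟨σ, σ.2, fun a => ?_⟩
  have h1 : (IsGaloisGroup.mulEquivAlgEquiv G (IntermediateField.fixedField G) K σ) a = e a := by
    rw [MulEquiv.apply_symm_apply]
  rw [he, ← h1]
  rfl

/-! ### Scalar plus nilpotent: residues and semisimple parts. -/

/-- The difference of the two commuting nilpotents is a nilpotent scalar. -/
theorem eq_of_isNilpotent_sub {E : Type*} [Ring E] [Algebra ℂ E] [Nontrivial E] {X : E} {μ ν : ℂ}
    (hμ : IsNilpotent (X - algebraMap ℂ E μ)) (hν : IsNilpotent (X - algebraMap ℂ E ν)) :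
    μ = ν := by
  have hc : Commute (X - algebraMap ℂ E ν) (X - algebraMap ℂ E μ) :=
    ((Commute.refl X).sub_right (Algebra.commute_algebraMap_right μ X)).sub_left
      (Algebra.commute_algebraMap_left ν _)
  have h := hc.isNilpotent_sub hν hμ
  rw [sub_sub_sub_cancel_left, ← map_sub, IsNilpotent.map_iff (algebraMap ℂ E).injective] at h
  exact sub_eq_zero.1 h.eq_zero

/-- Uniqueness of the scalar part makes it additive and multiplicative. -/
theorem exists_residue_algHom {B : Type*} [CommRing B] [Algebra ℂ B] [Nontrivial B]
    (hB : ∀ X : B, ∃ μ : ℂ, IsNilpotent (X - algebraMap ℂ B μ)) :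
    ∃ χ : B →ₐ[ℂ] ℂ, ∀ X, IsNilpotent (X - algebraMap ℂ B (χ X)) := by
  choose χ hχ using hB
  have huniq : ∀ X μ, IsNilpotent (X - algebraMap ℂ B μ) → χ X = μ := fun X μ h =>
    eq_of_isNilpotent_sub (hχ X) h
  have hmap : ∀ c : ℂ, χ (algebraMap ℂ B c) = c := fun c => huniq _ _ (by simp)
  refine ⟨{ toFun := χ
            map_one' := by simpa using hmap 1
            map_zero' := by simpa using hmap 0
            map_mul' := fun X Z => huniq _ _ ?_
            map_add' := fun X Z => huniq _ _ ?_
            commutes' := hmap }, hχ⟩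
  · have h1 : X * Z - algebraMap ℂ B (χ X * χ Z) =
        (X - algebraMap ℂ B (χ X)) * Z + algebraMap ℂ B (χ X) * (Z - algebraMap ℂ B (χ Z)) := by
      rw [map_mul]; ring
    rw [h1]
    exact (Commute.all _ _).isNilpotent_add
      ((Commute.all _ _).isNilpotent_mul_right (hχ X))
      ((Commute.all _ _).isNilpotent_mul_left (hχ Z))
  · have h1 : X + Z - algebraMap ℂ B (χ X + χ Z) =
        (X - algebraMap ℂ B (χ X)) + (Z - algebraMap ℂ B (χ Z)) := by
      rw [map_add]; ring
    rw [h1]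
    exact (Commute.all _ _).isNilpotent_add (hχ X) (hχ Z)

/-- In a commutative algebra all of whose elements are scalar plus nilpotent, the semisimple part
is the scalar. -/
theorem semisimplePart_eq_algebraMap {B : Type*} [Ring B] [Algebra ℂ B] [Nontrivial B]
    (hcomm : ∀ x y : B, x * y = y * x)
    (hB : ∀ X : B, ∃ μ : ℂ, IsNilpotent (X - algebraMap ℂ B μ)) {X : B} {μ : ℂ}
    (hX : IsNilpotent (X - algebraMap ℂ B μ)) : semisimplePart X = algebraMap ℂ B μ := by
  have hjac : ∀ x : B, IsNilpotent x → x ∈ Ring.jacobson B := by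
    let cr : CommRing B := { ‹Ring B› with mul_comm := hcomm }
    exact fun x hx => @nilradical_le_jacobson B cr x hx
  -- The algebra is local, so it has only the trivial idempotents and their span is the scalars.
  have hidem : ∀ e : B, IsIdempotentElem e → e = 0 ∨ e = 1 := by
    intro e he
    obtain ⟨ν, hν⟩ := hB e
    by_cases h0 : ν = 0
    · left
      rw [h0, map_zero, sub_zero] at hν
      obtain ⟨n, hn⟩ := hν
      rcases Nat.eq_zero_or_pos n with rfl | hpos
      · rw [pow_zero] at hn; exact absurd hn one_ne_zero
      · rwa [he.pow_eq hpos.ne'] at hn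
    · right
      have hu : IsUnit (algebraMap ℂ B ν) := (IsUnit.mk0 ν h0).map _
      have := hν.isUnit_add_left_of_commute hu (hcomm _ _)
      rw [add_sub_cancel] at this
      exact this.mul_left_cancel (he.trans (mul_one e).symm)
  have hspan : ∀ S ∈ Submodule.span ℂ {e : B | IsIdempotentElem e},
      ∃ ν : ℂ, S = algebraMap ℂ B ν := by
    intro S hS
    have hle : Submodule.span ℂ {e : B | IsIdempotentElem e} ≤
        LinearMap.range (Algebra.linearMap ℂ B) := by
      rw [Submodule.span_le]
      intro e he
      rcases hidem e he with rfl | rfl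
      · exact ⟨0, by simp⟩
      · exact ⟨1, by simp⟩
    obtain ⟨ν, hν⟩ := hle hS
    exact ⟨ν, hν.symm⟩
  have hspec : ∃ S : B, S ∈ Submodule.span ℂ {e : B | IsIdempotentElem e} ∧
      X - S ∈ Ring.jacobson B := by
    refine ⟨algebraMap ℂ B μ, ?_, hjac _ hX⟩
    rw [Algebra.algebraMap_eq_smul_one]
    exact Submodule.smul_mem _ _ (Submodule.subset_span IsIdempotentElem.one)
  obtain ⟨h1, h2⟩ := Classical.epsilon_spec hspec
  change semisimplePart X ∈ _ at h1
  change X - semisimplePart X ∈ _ at h2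
  obtain ⟨ν, hν⟩ := hspan _ h1
  rw [hν] at h2 ⊢
  -- Two different scalars congruent modulo the Jacobson radical would put a unit into it.
  by_contra hne
  have hμν : μ - ν ≠ 0 := fun h => hne (by rw [sub_eq_zero.1 h])
  have h3 := (Ring.jacobson B).sub_mem h2 (hjac _ hX)
  rw [sub_sub_sub_cancel_left, ← map_sub] at h3
  have hu : IsUnit (algebraMap ℂ B (μ - ν)) := (IsUnit.mk0 _ hμν).map _
  have htop := Ideal.eq_top_of_isUnit_mem _ h3 hu
  rw [← Ideal.jacobson_bot, Ideal.jacobson_eq_top_iff] at htop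
  exact bot_ne_top htop

/-! ### The local algebra of an indecomposable module. -/

section Modules

variable {A : Type*} {M : Type w} [CommRing A] [Algebra ℂ A] [AddCommGroup M] [Module ℂ M]
  [FiniteDimensional ℂ M] [Nontrivial M] {Y : A →ₗ[ℂ] (ℚ → Module.End ℂ M)}

/-- Operators commuting with an indecomposable module are scalar plus nilpotent. -/
theorem IsIndecomposable.exists_isNilpotent_sub (hY : IsIndecomposable Y) {X : Module.End ℂ M}
    (hX : ∀ a i, X * Y a i = Y a i * X) :
    ∃ μ : ℂ, IsNilpotent (X - algebraMap ℂ (Module.End ℂ M) μ) := by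
  obtain ⟨μ, hμ⟩ := Module.End.exists_eigenvalue X
  refine ⟨μ, ?_⟩
  set f := X - algebraMap ℂ (Module.End ℂ M) μ with hf
  have hcomm : ∀ a i, Commute f (Y a i) := fun a i =>
    Commute.sub_left (hX a i) (Algebra.commutes μ (Y a i))
  have hpow : ∀ a i n w, (f ^ n) (Y a i w) = Y a i ((f ^ n) w) := fun a i n w => by
    rw [← Module.End.mul_apply, ((hcomm a i).pow_left n).eq, Module.End.mul_apply]
  have h1 : IsStable Y (⨆ n, LinearMap.ker (f ^ n)) := by
    intro a i w hw
    have hle : (⨆ n, LinearMap.ker (f ^ n)) ≤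
        Submodule.comap (Y a i) (⨆ n, LinearMap.ker (f ^ n)) := by
      refine iSup_le fun n w hw => ?_
      rw [Submodule.mem_comap]
      refine Submodule.mem_iSup_of_mem n ?_
      rw [LinearMap.mem_ker] at hw ⊢
      rw [hpow, hw, map_zero]
    exact hle hw
  have h2 : IsStable Y (⨅ n, LinearMap.range (f ^ n)) := by
    intro a i w hw
    rw [Submodule.mem_iInf] at hw ⊢
    intro n
    obtain ⟨v, rfl⟩ := hw n
    exact ⟨Y a i v, hpow a i n v⟩
  -- Fitting decomposition of `f`. Both summands are submodules; the first contains an eigenvector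
  -- of `X`, so the second is zero.
  have hcompl := LinearMap.isCompl_iSup_ker_pow_iInf_range_pow f
  rcases hY _ _ h1 h2 hcompl with h | h
  · exfalso
    obtain ⟨v, hv⟩ := hμ.exists_hasEigenvector
    have hv1 : v ∈ (⨆ n, LinearMap.ker (f ^ n)) := by
      refine Submodule.mem_iSup_of_mem 1 ?_
      rw [pow_one, LinearMap.mem_ker, hf, LinearMap.sub_apply, hv.apply_eq_smul]
      simp [Module.algebraMap_end_apply]
    rw [h, Submodule.mem_bot] at hv1
    exact hv.2 hv1
  · rw [h] at hcompl
    obtain ⟨n, hn⟩ := (LinearMap.eventually_iSup_ker_pow_eq f).exists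
    have htop := hcompl.sup_eq_top
    rw [sup_bot_eq] at htop
    rw [htop] at hn
    exact ⟨n, LinearMap.ker_eq_top.1 hn.symm⟩

/-- A commutative algebra of operators commuting with an indecomposable module, as a local algebra
with residue field `ℂ`. -/
theorem IsIndecomposable.exists_local_model (hY : IsIndecomposable Y)
    {S : Subalgebra ℂ (Module.End ℂ M)} (hS : ∀ x ∈ S, ∀ y ∈ S, x * y = y * x)
    (hSY : ∀ x ∈ S, ∀ a i, x * Y a i = Y a i * x) :
    ∃ (B : Type w) (_ : CommRing B) (_ : Algebra ℂ B) (j : B →ₐ[ℂ] Module.End ℂ M)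
      (χ : B →ₐ[ℂ] ℂ), Function.Injective j ∧ (∀ x ∈ S, ∃ b, j b = x) ∧ (∀ b, j b ∈ S) ∧
      (∀ b, IsNilpotent (b - algebraMap ℂ B (χ b))) ∧
      IsNilpotent (RingHom.ker (χ : B →+* ℂ)) := by
  let cr : CommRing S := { S.toRing with mul_comm := fun x y => Subtype.ext (hS x x.2 y y.2) }
  have hnt : Nontrivial S := inferInstance
  have hfd : Module.Finite ℂ S := inferInstance
  have hnoeth : IsNoetherianRing S := IsNoetherianRing.of_finite ℂ S
  obtain ⟨χ, hχ⟩ := exists_residue_algHom (B := S) (fun X => by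
    obtain ⟨μ, hμ⟩ := hY.exists_isNilpotent_sub (hSY X X.2)
    exact ⟨μ, (IsNilpotent.map_iff (f := S.val) Subtype.val_injective).1 hμ⟩)
  refine ⟨S, cr, inferInstance, S.val, χ, Subtype.val_injective, fun x hx => ⟨⟨x, hx⟩, rfl⟩,
    fun b => b.2, hχ, ?_⟩
  -- Finite dimension makes the kernel finitely generated, so a nil ideal is nilpotent.
  rw [Ideal.FG.isNilpotent_iff_le_nilradical (IsNoetherian.noetherian _)]
  intro b hb
  have h0 : χ b = 0 := hb
  have := hχ b
  rwa [h0, map_zero, sub_zero] at this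

theorem exists_factor_of_coeff_mem {R B E : Type*} [Semiring R] [Ring B] [Ring E] {j : B →+* E}
    (hj : Function.Injective j) (T : R →+* HahnSeries ℚ E)
    (hT : ∀ a q, ∃ b, j b = (T a).coeff q) :
    ∃ T' : R →+* HahnSeries ℚ B, ∀ a, mapCoeff j (T' a) = T a := by
  choose t ht using hT
  have hinj : Function.Injective (mapCoeff j) := fun x y h => by
    ext q
    apply hj
    rw [← coeff_mapCoeff, h, coeff_mapCoeff]
  let t' : R → HahnSeries ℚ B := fun a =>
    ⟨t a, (T a).isPWO_support.mono fun q hq h => hq (hj (by rw [ht, h, map_zero]))⟩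
  have hts : ∀ a, mapCoeff j (t' a) = T a := fun a => HahnSeries.ext (funext fun q => ht a q)
  exact ⟨{  toFun := t'
            map_one' := hinj (by rw [hts, map_one, map_one])
            map_mul' := fun a b => hinj (by simp only [hts, map_mul])
            map_zero' := hinj (by rw [hts, map_zero, map_zero])
            map_add' := fun a b => hinj (by simp only [hts, map_add]) }, hts⟩

/-- `φ` is the semisimple part of the operator-valued series `T`. -/
def IsResidue {R : Type*} [Semiring R] (T : R →+* HahnSeries ℚ (Module.End ℂ M))
    (φ : R →+* HahnSeries ℚ ℂ) : Prop :=
  ∀ a q, IsNilpotent ((T a).coeff q - algebraMap ℂ (Module.End ℂ M) ((φ a).coeff q))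

variable {S : Subalgebra ℂ (Module.End ℂ M)}

theorem IsIndecomposable.exists_isResidue (hY : IsIndecomposable Y)
    (hS : ∀ x ∈ S, ∀ y ∈ S, x * y = y * x) (hSY : ∀ x ∈ S, ∀ a i, x * Y a i = Y a i * x)
    {R : Type*} [Semiring R] (T : R →+* HahnSeries ℚ (Module.End ℂ M))
    (hT : ∀ a q, (T a).coeff q ∈ S) : ∃ φ, IsResidue T φ := by
  obtain ⟨B, _, _, j, χ, hj, hSj, hjS, hχ, -⟩ := hY.exists_local_model hS hSY
  obtain ⟨T', hT'⟩ := exists_factor_of_coeff_mem (j := (j : B →+* Module.End ℂ M)) hj T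
    fun a q => hSj _ (hT a q)
  refine ⟨(mapCoeff (χ : B →+* ℂ)).comp T', fun a q => ?_⟩
  have := (hχ ((T' a).coeff q)).map j
  rw [map_sub, AlgHom.commutes] at this
  rw [← hT']
  exact this

section Extension

variable {F K : Type*} [Field F] [Field K] [Algebra F K] [Algebra.IsSeparable F K]

/-- Formally étale lifting in the local model of `S`, whose residue map carries `T₀` to the
restriction of `φ`. -/
theorem IsIndecomposable.exists_extension (hY : IsIndecomposable Y)
    (hS : ∀ x ∈ S, ∀ y ∈ S, x * y = y * x) (hSY : ∀ x ∈ S, ∀ a i, x * Y a i = Y a i * x)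
    (T₀ : F →+* HahnSeries ℚ (Module.End ℂ M)) (hT₀ : ∀ a q, (T₀ a).coeff q ∈ S)
    (φ : K →+* HahnSeries ℚ ℂ) (hφ : IsResidue T₀ (φ.comp (algebraMap F K))) :
    ∃ T : K →+* HahnSeries ℚ (Module.End ℂ M), (∀ a q, (T a).coeff q ∈ S) ∧
      (∀ a, T (algebraMap F K a) = T₀ a) ∧ IsResidue T φ := by
  obtain ⟨B, _, _, j, χ, hj, hSj, hjS, hχ, hnil⟩ := hY.exists_local_model hS hSY
  obtain ⟨T', hT'⟩ := exists_factor_of_coeff_mem (j := (j : B →+* Module.End ℂ M)) hj T₀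
    fun a q => hSj _ (hT₀ a q)
  have hres : ∀ (x : HahnSeries ℚ B) q, IsNilpotent
      ((mapCoeff (j : B →+* Module.End ℂ M) x).coeff q - algebraMap ℂ (Module.End ℂ M)
        ((mapCoeff (χ : B →+* ℂ) x).coeff q)) := by
    intro x q
    have := (hχ (x.coeff q)).map j
    rw [map_sub, AlgHom.commutes] at this
    exact this
  obtain ⟨T, hTF, hTφ⟩ := exists_lift_of_residue hnil T' φ (fun a => by
    ext q
    refine eq_of_isNilpotent_sub (hφ a q) ?_
    rw [← hT']
    exact hres _ q)
  refine ⟨(mapCoeff (j : B →+* Module.End ℂ M)).comp T, fun a q => hjS _, fun a => ?_,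
    fun a q => ?_⟩
  · rw [RingHom.comp_apply, hTF, hT']
  · rw [RingHom.comp_apply, ← hTφ]
    exact hres _ q

/-- Both series must have coefficients in one commutative `S`, since the lifting argument takes
place in its local model. -/
theorem IsIndecomposable.extension_unique (hY : IsIndecomposable Y)
    (hS : ∀ x ∈ S, ∀ y ∈ S, x * y = y * x) (hSY : ∀ x ∈ S, ∀ a i, x * Y a i = Y a i * x)
    {T₁ T₂ : K →+* HahnSeries ℚ (Module.End ℂ M)} (h₁ : ∀ a q, (T₁ a).coeff q ∈ S)
    (h₂ : ∀ a q, (T₂ a).coeff q ∈ S)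
    (hF : ∀ a, T₁ (algebraMap F K a) = T₂ (algebraMap F K a))
    {φ : K →+* HahnSeries ℚ ℂ} (hφ₁ : IsResidue T₁ φ) (hφ₂ : IsResidue T₂ φ) : T₁ = T₂ := by
  obtain ⟨B, _, _, j, χ, hj, hSj, hjS, hχ, hnil⟩ := hY.exists_local_model hS hSY
  have hjinj : Function.Injective (mapCoeff (j : B →+* Module.End ℂ M)) := fun x y h => by
    ext q
    apply hj
    exact congrArg (fun z => z.coeff q) h
  obtain ⟨T₁', hT₁⟩ := exists_factor_of_coeff_mem (j := (j : B →+* Module.End ℂ M)) hj T₁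
    fun a q => hSj _ (h₁ a q)
  obtain ⟨T₂', hT₂⟩ := exists_factor_of_coeff_mem (j := (j : B →+* Module.End ℂ M)) hj T₂
    fun a q => hSj _ (h₂ a q)
  have hres : ∀ {T : K →+* HahnSeries ℚ (Module.End ℂ M)} {T' : K →+* HahnSeries ℚ B},
      (∀ a, mapCoeff (j : B →+* Module.End ℂ M) (T' a) = T a) → IsResidue T φ →
      ∀ a, mapCoeff (χ : B →+* ℂ) (T' a) = φ a := by
    intro T T' hT hφ a
    ext q
    refine eq_of_isNilpotent_sub ?_ (hφ a q)
    have := (hχ ((T' a).coeff q)).map j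
    rw [map_sub, AlgHom.commutes] at this
    rw [← hT]
    exact this
  have := lift_eq_of_residue_eq (F := F) hnil (T₁ := T₁') (T₂ := T₂')
    (fun a => hjinj (by rw [hT₁, hT₂, hF]))
    (fun a => by rw [hres hT₁ hφ₁, hres hT₂ hφ₂])
  ext1 a
  rw [← hT₁, ← hT₂, this]

/-- The defect `δ = x (d/dx) T - x T D` is a derivation along `T` that vanishes on `F`, hence is
zero. The factor `x` lets the Euler operator replace `d/dx`. -/
theorem IsIndecomposable.derivation_extension [Algebra ℂ K] (hY : IsIndecomposable Y)
    (hS : ∀ x ∈ S, ∀ y ∈ S, x * y = y * x) (hSY : ∀ x ∈ S, ∀ a i, x * Y a i = Y a i * x)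
    (D : Derivation ℂ K K) {T : K →+* HahnSeries ℚ (Module.End ℂ M)}
    (hT : ∀ a q, (T a).coeff q ∈ S)
    (hF : ∀ (a : F) q, (T (D (algebraMap F K a))).coeff q =
      ((q + 1 : ℚ) : ℂ) • (T (algebraMap F K a)).coeff (q + 1)) (a : K) (q : ℚ) :
    (T (D a)).coeff q = ((q + 1 : ℚ) : ℂ) • (T a).coeff (q + 1) := by
  obtain ⟨B, _, _, j, χ, hj, hSj, hjS, -, -⟩ := hY.exists_local_model hS hSY
  obtain ⟨T', hT'⟩ := exists_factor_of_coeff_mem (j := (j : B →+* Module.End ℂ M)) hj T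
    fun a q => hSj _ (hT a q)
  have hcoeff : ∀ a q, j ((T' a).coeff q) = (T a).coeff q := fun a q => by
    rw [← hT']; rfl
  let θ : HahnSeries ℚ B → HahnSeries ℚ B := diagonal fun q => (q : ℂ)
  let δ : K →+ HahnSeries ℚ B :=
    { toFun := fun a => θ (T' a) - HahnSeries.single 1 1 * T' (D a)
      map_zero' := by
        rw [map_zero, map_zero, map_zero, mul_zero, sub_zero]
        ext q
        simp [θ]
      map_add' := fun a b => by
        simp only [map_add, θ, diagonal_add]
        ring }
  have hδcoeff : ∀ a q, (δ a).coeff (q + 1) =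
      ((q + 1 : ℚ) : ℂ) • (T' a).coeff (q + 1) - (T' (D a)).coeff q := by
    intro a q
    change (θ (T' a) - HahnSeries.single 1 1 * T' (D a)).coeff (q + 1) = _
    rw [HahnSeries.coeff_sub, add_comm q 1, add_comm 1 q, HahnSeries.coeff_single_mul]
    simp [θ]
  have hδ := eq_zero_of_leibniz (F := F) T' δ (fun a b => by
      change θ (T' (a * b)) - HahnSeries.single 1 1 * T' (D (a * b)) =
        T' a * (θ (T' b) - HahnSeries.single 1 1 * T' (D b)) +
          T' b * (θ (T' a) - HahnSeries.single 1 1 * T' (D a))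
      rw [map_mul, D.leibniz, map_add, smul_eq_mul, smul_eq_mul, map_mul, map_mul]
      simp only [θ]
      rw [diagonal_leibniz (fun a b => by push_cast; rfl)]
      ring)
    (fun a => by
      ext q
      obtain ⟨q, rfl⟩ : ∃ q', q = q' + 1 := ⟨q - 1, by ring⟩
      rw [hδcoeff, HahnSeries.coeff_zero]
      apply hj
      rw [map_sub, map_smul, hcoeff, hcoeff, hF, sub_self, map_zero])
  have := hδcoeff a q
  rw [hδ, HahnSeries.coeff_zero] at this
  have := congrArg j this
  rw [map_sub, map_smul, hcoeff, hcoeff, map_zero] at this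
  exact (sub_eq_zero.1 this.symm).symm

end Extension

end Modules

/-! ### Mode algebras, and recovery of `g` from the modes. -/

theorem modeAlgebra_comm {A M : Type*} [CommRing A] [Algebra ℂ A] [AddCommGroup M] [Module ℂ M]
    {Y : A →ₗ[ℂ] (ℚ → Module.End ℂ M)} (hY : ∀ u v i j, Y u i * Y v j = Y v j * Y u i) :
    ∀ x ∈ modeAlgebra Y, ∀ y ∈ modeAlgebra Y, x * y = y * x := by
  intro x hx y hy
  have hcomm := Algebra.isMulCommutative_adjoin ℂ (s := {X | ∃ (a : A) (i : ℚ), X = Y a i}) (by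
    rintro _ ⟨a, i, rfl⟩ _ ⟨b, j, rfl⟩
    exact hY a b i j)
  exact congrArg Subtype.val (hcomm.is_comm.comm ⟨x, hx⟩ ⟨y, hy⟩)

theorem mode_mem_modeAlgebra {A M : Type*} [CommRing A] [Algebra ℂ A] [AddCommGroup M]
    [Module ℂ M] (Y : A →ₗ[ℂ] (ℚ → Module.End ℂ M)) (a : A) (i : ℚ) : Y a i ∈ modeAlgebra Y :=
  Algebra.subset_adjoin ⟨a, i, rfl⟩

section Twist

variable {K M : Type*} [Field K] [Algebra ℂ K] [AddCommGroup M] [Module ℂ M] {ζ : ℕ → ℂ}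
  {D : Derivation ℂ K K} {g₁ g₂ : K ≃ₐ[ℂ] K} {Y₁ Y₂ : K →ₗ[ℂ] (ℚ → Module.End ℂ M)}

theorem IsTwistedModule.mode_pow (h : IsTwistedModule ζ D g₁ Y₁)
    (hζ : IsPrimitiveRoot (ζ (orderOf g₁)) (orderOf g₁)) (k : ℤ) (n : ℕ) (u : K) :
    Y₁ ((g₁ ^ n) u) (k / orderOf g₁) = (ζ (orderOf g₁) ^ k) ^ n • Y₁ u (k / orderOf g₁) := by
  induction n with
  | zero => simp
  | succ n ih =>
    rw [pow_succ', AlgEquiv.mul_apply, h.mode_automorphism hζ, ih, smul_smul, ← pow_succ']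

/-- As `Y₂` is a translate of `Y₁`, its nonzero modes have indices in both `(1/p₁)ℤ` and `(1/p₂)ℤ`.
On such modes the scalar by which `g₂ ^ p₁` acts is a power of `ζ_{p₂} ^ p₂ = 1`. -/
theorem IsTwistedModule.orderOf_dvd (h₁ : IsTwistedModule ζ D g₁ Y₁)
    (h₂ : IsTwistedModule ζ D g₂ Y₂) (hζ : IsPrimitiveRoot (ζ (orderOf g₂)) (orderOf g₂))
    {σ : K ≃ₐ[ℂ] K} (hσ : ∀ a, Y₂ a = Y₁ (σ a)) (hinj : Function.Injective Y₂) :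
    orderOf g₂ ∣ orderOf g₁ := by
  have hp₁ : (orderOf g₁ : ℚ) ≠ 0 := by exact_mod_cast h₁.finite_order.ne'
  have hp₂ : (orderOf g₂ : ℚ) ≠ 0 := by exact_mod_cast h₂.finite_order.ne'
  apply orderOf_dvd_of_pow_eq_one
  ext u
  apply hinj
  funext i
  by_cases hi₁ : ∃ k : ℤ, i = (k : ℚ) / (orderOf g₁ : ℚ)
  · by_cases hi₂ : ∃ k : ℤ, i = (k : ℚ) / (orderOf g₂ : ℚ)
    · obtain ⟨k₁, hk₁⟩ := hi₁
      obtain ⟨k₂, rfl⟩ := hi₂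
      have hk : k₂ * (orderOf g₁ : ℤ) = orderOf g₂ * k₁ := by
        rw [div_eq_div_iff hp₂ hp₁] at hk₁
        have : (k₂ : ℚ) * orderOf g₁ = orderOf g₂ * k₁ := by rw [hk₁]; ring
        exact_mod_cast this
      rw [h₂.mode_pow hζ, ← zpow_natCast, ← zpow_mul, hk, zpow_mul, zpow_natCast, hζ.pow_eq_one,
        one_zpow, one_smul]
      rfl
    · rw [h₂.support _ _ hi₂, h₂.support _ _ hi₂]
  · rw [hσ, hσ, h₁.support _ _ hi₁, h₁.support _ _ hi₁]

/-- Both automorphisms multiply the mode of index `k / p` by `ζ_p ^ k`, and the modes determine the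
element. Equality of orders comes first, because the roots `ζ p` for different `p` are unrelated. -/
theorem IsTwistedModule.conj_eq (hζ : ∀ p : ℕ, 0 < p → IsPrimitiveRoot (ζ p) p)
    (h₁ : IsTwistedModule ζ D g₁ Y₁) (h₂ : IsTwistedModule ζ D g₂ Y₂)
    {σ : K ≃ₐ[ℂ] K} (hσ : ∀ a, Y₂ a = Y₁ (σ a)) (hinj₁ : Function.Injective Y₁)
    (hinj₂ : Function.Injective Y₂) : σ⁻¹ * g₁ * σ = g₂ := by
  have hσ' : ∀ a, Y₁ a = Y₂ (σ⁻¹ a) := fun a => by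
    rw [hσ, ← AlgEquiv.mul_apply, mul_inv_cancel, AlgEquiv.one_apply]
  have hord : orderOf g₂ = orderOf g₁ :=
    Nat.dvd_antisymm (h₁.orderOf_dvd h₂ (hζ _ h₂.finite_order) hσ hinj₂)
      (h₂.orderOf_dvd h₁ (hζ _ h₁.finite_order) hσ' hinj₁)
  ext u
  apply hinj₂
  funext i
  by_cases hi : ∃ k : ℤ, i = (k : ℚ) / (orderOf g₂ : ℚ)
  · obtain ⟨k, rfl⟩ := hi
    rw [h₂.mode_automorphism (hζ _ h₂.finite_order), AlgEquiv.mul_apply, AlgEquiv.mul_apply,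
      ← hσ', hord, h₁.mode_automorphism (hζ _ h₁.finite_order), hσ]
  · rw [h₂.support _ _ hi, h₂.support _ _ hi]

end Twist

/-! ### Rigidity of twisted structures over a given module. -/

section Structures

variable {K M : Type*} [Field K] [Algebra ℂ K] [AddCommGroup M] [Module ℂ M]
  {ζ : ℕ → ℂ} {D : Derivation ℂ K K} {G : Subgroup (K ≃ₐ[ℂ] K)} {g : K ≃ₐ[ℂ] K}
  {Y : IntermediateField.fixedField G →ₗ[ℂ] (ℚ → Module.End ℂ M)}
  {Y' : K →ₗ[ℂ] (ℚ → Module.End ℂ M)}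

theorem IsTwistedStructureOver.modeAlgebra_commute (h : IsTwistedStructureOver ζ D G Y g Y')
    (hζ : IsPrimitiveRoot (ζ (orderOf g)) (orderOf g)) :
    ∀ x ∈ modeAlgebra Y', ∀ a i, x * Y a i = Y a i * x := fun x hx a i =>
  modeAlgebra_comm (h.1.mode_comm hζ) x hx _ (h.2 a ▸ mode_mem_modeAlgebra Y' (a : K) i)

theorem IsTwistedStructureOver.modeAlgebra_le (h : IsTwistedStructureOver ζ D G Y g Y') :
    modeAlgebra Y ≤ modeAlgebra Y' := by
  refine Algebra.adjoin_le ?_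
  rintro _ ⟨a, i, rfl⟩
  rw [← h.2 a]
  exact mode_mem_modeAlgebra Y' (a : K) i

theorem IsVertexModule.modeAlgebra_comm {hD : ∀ g ∈ G, ∀ a : K, g (D a) = D (g a)}
    (hY : IsVertexModule (fixedDerivation D G hD) Y) :
    ∀ x ∈ modeAlgebra Y, ∀ y ∈ modeAlgebra Y, x * y = y * x :=
  DiffVertex.modeAlgebra_comm
    (IsTwistedModule.mode_comm hY (by rw [orderOf_one]; exact IsPrimitiveRoot.one))

variable [FiniteDimensional ℂ M]

theorem exists_base_series {hD : ∀ g ∈ G, ∀ a : K, g (D a) = D (g a)}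
    (hY : IsVertexModule (fixedDerivation D G hD) Y) :
    ∃ T : IntermediateField.fixedField G →ₐ[ℂ] HahnSeries ℚ (Module.End ℂ M),
      ∀ a q, (T a).coeff q = Y a (-q - 1) :=
  IsTwistedModule.exists_series hY (by rw [orderOf_one]; exact IsPrimitiveRoot.one)

variable [Nontrivial M]

/-- The semisimple part of a twisted structure is a scalar-valued homomorphism. -/
theorem IsTwistedStructureOver.exists_residue (hindec : IsIndecomposable Y)
    (h : IsTwistedStructureOver ζ D G Y g Y')
    (hζ : IsPrimitiveRoot (ζ (orderOf g)) (orderOf g)) :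
    ∃ (T : K →ₐ[ℂ] HahnSeries ℚ (Module.End ℂ M)) (φ : K →+* HahnSeries ℚ ℂ),
      (∀ a q, (T a).coeff q = Y' a (-q - 1)) ∧ IsResidue T.toRingHom φ ∧
      ∀ a i, psi Y' a i = algebraMap ℂ (Module.End ℂ M) ((φ a).coeff (-i - 1)) := by
  obtain ⟨T, hT⟩ := h.1.exists_series hζ
  have hcomm := modeAlgebra_comm (h.1.mode_comm hζ)
  have hc := h.modeAlgebra_commute hζ
  obtain ⟨φ, hφ⟩ := hindec.exists_isResidue hcomm hc T.toRingHom (fun a q => by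
    change (T a).coeff q ∈ _
    rw [hT]; exact mode_mem_modeAlgebra _ _ _)
  refine ⟨T, φ, hT, hφ, fun a i => ?_⟩
  have hval : Function.Injective (modeAlgebra Y').val := Subtype.val_injective
  have hn := hφ a (-i - 1)
  change IsNilpotent ((T a).coeff (-i - 1) - _) at hn
  rw [hT, show -(-i - 1) - 1 = i by ring] at hn
  have := semisimplePart_eq_algebraMap (B := modeAlgebra Y')
    (X := ⟨Y' a i, mode_mem_modeAlgebra Y' a i⟩) (μ := (φ a).coeff (-i - 1))
    (fun x y => Subtype.ext (hcomm x x.2 y y.2))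
    (fun X => by
      obtain ⟨μ, hμ⟩ := hindec.exists_isNilpotent_sub (hc X X.2)
      exact ⟨μ, (IsNilpotent.map_iff hval).1 hμ⟩)
    ((IsNilpotent.map_iff hval).1 hn)
  exact congrArg Subtype.val this

theorem isSeparable_fixedField {K : Type*} [Field K] [Algebra ℂ K]
    (G : Subgroup (K ≃ₐ[ℂ] K)) [Finite G] : Algebra.IsSeparable (IntermediateField.fixedField G) K := by
  have hgal := isGaloisGroup_fixedField G
  have : IsGalois (IntermediateField.fixedField G) K := IsGaloisGroup.isGalois G _ K
  infer_instance

/-- Structures over the same module with the same semisimple part coincide. -/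
theorem eq_of_isResidue [Finite G] {hD : ∀ g ∈ G, ∀ a : K, g (D a) = D (g a)}
    (hY : IsVertexModule (fixedDerivation D G hD) Y) (hindec : IsIndecomposable Y)
    (hζ : ∀ p : ℕ, 0 < p → IsPrimitiveRoot (ζ p) p) {g₁ g₂ : K ≃ₐ[ℂ] K}
    {Y₁ Y₂ : K →ₗ[ℂ] (ℚ → Module.End ℂ M)}
    (h₁ : IsTwistedStructureOver ζ D G Y g₁ Y₁) (h₂ : IsTwistedStructureOver ζ D G Y g₂ Y₂)
    {T₁ T₂ : K →ₐ[ℂ] HahnSeries ℚ (Module.End ℂ M)}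
    (hT₁ : ∀ a q, (T₁ a).coeff q = Y₁ a (-q - 1)) (hT₂ : ∀ a q, (T₂ a).coeff q = Y₂ a (-q - 1))
    {σ : K ≃ₐ[ℂ] K} (hσ : σ ∈ G) {φ : K →+* HahnSeries ℚ ℂ}
    (hφ₁ : IsResidue (T₁.toRingHom.comp (σ : K →+* K)) φ) (hφ₂ : IsResidue T₂.toRingHom φ)
    (a : K) : Y₂ a = Y₁ (σ a) := by
  have hsep : Algebra.IsSeparable (IntermediateField.fixedField G) K := isSeparable_fixedField G
  obtain ⟨T₀, hT₀⟩ := exists_base_series hY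
  have key : ∀ {g' : K ≃ₐ[ℂ] K} {Y' : K →ₗ[ℂ] (ℚ → Module.End ℂ M)},
      IsTwistedStructureOver ζ D G Y g' Y' →
      ∀ T' T : K →+* HahnSeries ℚ (Module.End ℂ M), (∀ a q, (T' a).coeff q ∈ modeAlgebra Y') →
      (∀ a q, (T a).coeff q ∈ modeAlgebra Y) →
      (∀ a : IntermediateField.fixedField G, T' a = T₀ a) →
      (∀ a : IntermediateField.fixedField G, T a = T₀ a) →
      IsResidue T' φ → IsResidue T φ → T' = T := by
    intro g' Y' h' T' T hT' hT hF' hF hr' hr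
    have hz := hζ _ h'.1.finite_order
    exact hindec.extension_unique (F := IntermediateField.fixedField G)
      (modeAlgebra_comm (h'.1.mode_comm hz)) (h'.modeAlgebra_commute hz) hT'
      (fun a q => h'.modeAlgebra_le (hT a q)) (fun a => (hF' a).trans (hF a).symm) hr' hr
  have hF₂ : ∀ a : IntermediateField.fixedField G, T₂ a = T₀ a := fun a => by
    ext1; funext q
    rw [hT₂, hT₀, h₂.2]
  have hF₁ : ∀ a : IntermediateField.fixedField G, T₁ (σ a) = T₀ a := fun a => by
    have : σ (a : K) = a := a.2 ⟨σ, hσ⟩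
    ext1; funext q
    rw [this, hT₁, hT₀, h₁.2]
  -- The mode algebras of `Y₁` and `Y₂` need not commute with each other, so the two series are not
  -- compared directly. Each is compared with a lift `T` over the mode algebra of `Y`, which lies in
  -- both.
  obtain ⟨T, hTS, hTF, hTφ⟩ := hindec.exists_extension hY.modeAlgebra_comm
    (fun x hx a i => hY.modeAlgebra_comm x hx _ (mode_mem_modeAlgebra Y a i)) T₀.toRingHom
    (fun a q => by
      change (T₀ a).coeff q ∈ _
      rw [hT₀]; exact mode_mem_modeAlgebra _ _ _) φ
    (fun a q => by
      have := hφ₂ (a : K) q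
      change IsNilpotent ((T₂ a).coeff q - _) at this
      rw [hF₂] at this
      exact this)
  have e₁ := key h₁ _ T (fun a q => by
    change (T₁ (σ a)).coeff q ∈ _
    rw [hT₁]; exact mode_mem_modeAlgebra _ _ _) hTS hF₁ hTF hφ₁ hTφ
  have e₂ := key h₂ _ T (fun a q => by
    change (T₂ a).coeff q ∈ _
    rw [hT₂]; exact mode_mem_modeAlgebra _ _ _) hTS hF₂ hTF hφ₂ hTφ
  have e : T₁ (σ a) = T₂ a := DFunLike.congr_fun (e₁.trans e₂.symm) a
  funext i
  have := congrArg (fun x => x.coeff (-i - 1)) e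
  simp only [hT₁, hT₂] at this
  rw [show -(-i - 1) - 1 = i by ring] at this
  exact this.symm

end Structures

/-! ### Monodromy and existence. -/

/-- The character `q ↦ exp (2πiq)` of `ℚ`. -/
noncomputable def expChar (q : ℚ) : ℂ := Complex.exp (2 * Real.pi * Complex.I * q)

theorem expChar_zero : expChar 0 = 1 := by simp [expChar]

theorem expChar_add (a b : ℚ) : expChar (a + b) = expChar a * expChar b := by
  rw [expChar, expChar, expChar, ← Complex.exp_add]
  congr 1
  push_cast
  ring

theorem expChar_eq_one_iff (q : ℚ) : expChar q = 1 ↔ ∃ n : ℤ, q = n := by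
  rw [expChar, Complex.exp_eq_one_iff]
  refine exists_congr fun n => ?_
  rw [mul_comm, mul_left_inj' Complex.two_pi_I_ne_zero]
  exact_mod_cast Iff.rfl

theorem expChar_pow (q : ℚ) (n : ℕ) : expChar q ^ n = expChar (n * q) := by
  rw [expChar, expChar, ← Complex.exp_nat_mul]
  congr 1
  push_cast
  ring

theorem expChar_div (k : ℤ) (p : ℕ) :
    expChar (k / p) = Complex.exp (2 * Real.pi * Complex.I / p) ^ k := by
  rw [expChar, ← Complex.exp_int_mul]
  congr 1
  push_cast
  ring

section Existence

variable {K M : Type*} [Field K] [Algebra ℂ K] [AddCommGroup M] [Module ℂ M]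
  [FiniteDimensional ℂ M] [Nontrivial M] {ζ : ℕ → ℂ}
  {D : Derivation ℂ K K} {G : Subgroup (K ≃ₐ[ℂ] K)} [Finite G]
  {Y : IntermediateField.fixedField G →ₗ[ℂ] (ℚ → Module.End ℂ M)}

/-- An extension of the series of `Y` to `K`, on which the monodromy `x ^ q ↦ exp (2πiq) x ^ q`
acts through an element of `G`. -/
theorem exists_series_with_monodromy {hD : ∀ g ∈ G, ∀ a : K, g (D a) = D (g a)}
    (hY : IsVertexModule (fixedDerivation D G hD) Y) (hindec : IsIndecomposable Y) :
    ∃ T : K →ₐ[ℂ] HahnSeries ℚ (Module.End ℂ M),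
      (∀ (a : IntermediateField.fixedField G) q, (T a).coeff q = Y a (-q - 1)) ∧
      (∀ a q, (T a).coeff q ∈ modeAlgebra Y) ∧
      (∀ u q, (T (D u)).coeff q = ((q + 1 : ℚ) : ℂ) • (T u).coeff (q + 1)) ∧
      ∃ g ∈ G, ∀ u q, (T (g u)).coeff q = expChar q • (T u).coeff q := by
  have hgal := isGaloisGroup_fixedField G
  have : FiniteDimensional (IntermediateField.fixedField G) K :=
    IsGaloisGroup.finiteDimensional G _ K
  have hsep : Algebra.IsSeparable (IntermediateField.fixedField G) K := isSeparable_fixedField G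
  have hS := hY.modeAlgebra_comm
  have hSY : ∀ x ∈ modeAlgebra Y, ∀ a i, x * Y a i = Y a i * x := fun x hx a i =>
    hS x hx _ (mode_mem_modeAlgebra Y a i)
  obtain ⟨T₀, hT₀⟩ := exists_base_series hY
  have hT₀S : ∀ a q, (T₀.toRingHom a).coeff q ∈ modeAlgebra Y := fun a q => by
    change (T₀ a).coeff q ∈ _
    rw [hT₀]; exact mode_mem_modeAlgebra _ _ _
  obtain ⟨φ₀, hφ₀⟩ := hindec.exists_isResidue hS hSY T₀.toRingHom hT₀S
  -- The untwisted series has integral exponents, so the monodromy fixes it.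
  have hint : ∀ a q, (T₀ a).coeff q ≠ 0 → ∃ n : ℤ, q = n := by
    intro a q hq
    by_contra hn
    rw [hT₀] at hq
    refine hq (hY.support a _ ?_)
    rintro ⟨k, hk⟩
    refine hn ⟨-k - 1, ?_⟩
    rw [orderOf_one, Nat.cast_one, div_one] at hk
    push_cast
    linarith
  have hintφ : ∀ a q, (φ₀ a).coeff q ≠ 0 → ∃ n : ℤ, q = n := by
    intro a q hq
    by_contra hn
    apply hq
    have h0 : (T₀ a).coeff q = 0 := by
      by_contra h
      exact hn (hint a q h)
    have h1 := hφ₀ a q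
    change IsNilpotent ((T₀ a).coeff q - _) at h1
    rw [h0] at h1
    exact (eq_of_isNilpotent_sub h1 (ν := 0) (by simp))
  obtain ⟨φ₀', hφ₀'⟩ := exists_laurent_factor 1 one_pos φ₀ (fun a q hq => by
    obtain ⟨n, hn⟩ := hintφ a q hq
    exact ⟨n, by simpa using hn⟩)
  obtain ⟨ψ, hψ⟩ := exists_extension_of_laurent (K := K) φ₀'
  have hψF : ∀ a : IntermediateField.fixedField G, ψ a = φ₀ a := fun a =>
    (hψ a).trans (hφ₀' a)
  obtain ⟨T, hTS, hTF, hTψ⟩ := hindec.exists_extension hS hSY T₀.toRingHom hT₀S ψ (fun a q => by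
    have := hφ₀ a q
    rw [← hψF] at this
    exact this)
  have hTF' : ∀ a : IntermediateField.fixedField G, T a = T₀ a := hTF
  have hDF : ∀ (a : IntermediateField.fixedField G) q,
      (T (D (algebraMap (IntermediateField.fixedField G) K a))).coeff q =
      ((q + 1 : ℚ) : ℂ) •
        (T (algebraMap (IntermediateField.fixedField G) K a)).coeff (q + 1) := by
    intro a q
    have h1 : D (algebraMap (IntermediateField.fixedField G) K a) =
        (fixedDerivation D G hD a : K) := rfl
    have h2 := IsTwistedModule.mode_derivation hY
      (by rw [orderOf_one]; exact IsPrimitiveRoot.one) (fun _ => rfl) a (-q - 1)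
    have h3 : T (algebraMap (IntermediateField.fixedField G) K a) = T₀ a := hTF a
    rw [h1, hTF', hT₀, h2, h3, hT₀, show -q - 1 - 1 = -(q + 1) - 1 by ring]
    congr 1
    push_cast
    ring
  have htw₁ : ∀ (a : IntermediateField.fixedField G),
      (characterTwist (Module.End ℂ M) expChar_zero expChar_add) (T a) = T a := by
    intro a
    ext1; funext q
    rw [coeff_characterTwist, hTF']
    by_cases hq : (T₀ a).coeff q = 0
    · rw [hq, smul_zero]
    · rw [(expChar_eq_one_iff q).2 (hint a q hq), one_smul]
  have htw₂ : ∀ (a : IntermediateField.fixedField G),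
      (characterTwist ℂ expChar_zero expChar_add) (ψ a) = ψ a := by
    intro a
    ext1; funext q
    rw [coeff_characterTwist, hψF]
    by_cases hq : (φ₀ a).coeff q = 0
    · rw [hq, smul_zero]
    · rw [(expChar_eq_one_iff q).2 (hintφ a q hq), one_smul]
  -- The monodromy transform of `ψ` also extends `φ₀`, so it is `ψ` composed with an element of `G`.
  obtain ⟨g, hg, hgψ⟩ := exists_mem_of_agree_on_fixedField G (φ₁ := ψ)
    (φ₂ := (characterTwist ℂ expChar_zero expChar_add).comp ψ) (fun a => (htw₂ a).symm)
  -- Both sides lift the same residue and restrict to `T₀`, so the monodromy relation passes from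
  -- `ψ` to `T`.
  have hTg : (characterTwist (Module.End ℂ M) expChar_zero expChar_add).comp T =
      T.comp (g : K →+* K) := by
    refine hindec.extension_unique (F := IntermediateField.fixedField G) hS hSY
      (φ := (characterTwist ℂ expChar_zero expChar_add).comp ψ) ?_ ?_ ?_ ?_ ?_
    · exact fun a q => Subalgebra.smul_mem _ (hTS a q) _
    · exact fun a q => hTS _ q
    · intro a
      have : g (a : K) = a := a.2 ⟨g, hg⟩
      change (characterTwist (Module.End ℂ M) expChar_zero expChar_add) (T a) = T (g a)
      rw [htw₁, this]
    · intro a q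
      have := (hTψ a q).smul (expChar q)
      rw [smul_sub, ← Algebra.linearMap_apply, ← map_smul] at this
      exact this
    · intro a q
      rw [hgψ a]
      exact hTψ (g a) q
  refine ⟨{ T with
    commutes' := fun c => ?_ }, fun a q => ?_, hTS, ?_, g, hg, fun u q => ?_⟩
  · have h1 : algebraMap ℂ K c =
        algebraMap (IntermediateField.fixedField G) K (algebraMap ℂ _ c) := rfl
    change T (algebraMap ℂ K c) = _
    rw [h1, hTF]
    exact T₀.commutes c
  · change (T a).coeff q = _
    rw [hTF', hT₀]
  · exact hindec.derivation_extension hS hSY D hTS hDF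
  · exact (congrArg (fun x : HahnSeries ℚ (Module.End ℂ M) => x.coeff q)
      (DFunLike.congr_fun hTg u)).symm

/-- The monodromy element `g₀` need not be the twist itself: the definition uses `ζ p` and the mode
index `-q - 1`, so the twist must act on `x ^ (k/p)` by `ζ_p ^ (-k)`. A power of `g₀` does. -/
theorem exists_twistedStructure (hζ : ∀ p : ℕ, 0 < p → IsPrimitiveRoot (ζ p) p)
    {hD : ∀ g ∈ G, ∀ a : K, g (D a) = D (g a)}
    (hY : IsVertexModule (fixedDerivation D G hD) Y) (hindec : IsIndecomposable Y) :
    ∃ g ∈ G, ∃ Y' : K →ₗ[ℂ] (ℚ → Module.End ℂ M), IsTwistedStructureOver ζ D G Y g Y' := by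
  obtain ⟨T, hTF, hTS, hTD, g₀, hg₀, hTg₀⟩ := exists_series_with_monodromy hY hindec
  have hpow : ∀ (n : ℕ) u q, (T ((g₀ ^ n) u)).coeff q = expChar q ^ n • (T u).coeff q := by
    intro n u q
    induction n with
    | zero => simp
    | succ n ih => rw [pow_succ', AlgEquiv.mul_apply, hTg₀, ih, smul_smul, ← pow_succ']
  have hfin : IsOfFinOrder g₀ := by
    have := isOfFinOrder_of_finite (⟨g₀, hg₀⟩ : G)
    exact (Submonoid.isOfFinOrder_coe).2 this
  set p := orderOf g₀ with hp
  have hp0 : 0 < p := hfin.orderOf_pos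
  have hpQ : (p : ℚ) ≠ 0 := by exact_mod_cast hp0.ne'
  -- The relation `g₀ ^ p = 1` forces `exp (2πiq) ^ p = 1` at every exponent that occurs.
  have hfrac : ∀ u q, (T u).coeff q ≠ 0 → ∃ k : ℤ, q = k / p := by
    intro u q hq
    have h1 := hpow p u q
    rw [hp, pow_orderOf_eq_one, AlgEquiv.one_apply, ← hp] at h1
    have h2 : (expChar q ^ p - 1) • (T u).coeff q = 0 := by
      rw [sub_smul, one_smul, ← h1, sub_self]
    have h3 := sub_eq_zero.1 ((smul_eq_zero.1 h2).resolve_right hq)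
    rw [expChar_pow, expChar_eq_one_iff] at h3
    obtain ⟨n, hn⟩ := h3
    exact ⟨n, by rw [← hn]; field_simp⟩
  have hω := Complex.isPrimitiveRoot_exp p hp0.ne'
  set ω := Complex.exp (2 * Real.pi * Complex.I / p) with hωdef
  have hζp := hζ p hp0
  have : NeZero p := ⟨hp0.ne'⟩
  -- Here `ω ^ j = ζ_p⁻¹`. Primitivity makes `j` prime to `p`, so `g₀ ^ j` still has order `p`.
  obtain ⟨j, -, hj⟩ := hω.eq_pow_of_pow_eq_one hζp.inv.pow_eq_one
  have hcop : j.Coprime p := (hω.pow_iff_coprime hp0 j).1 (hj ▸ hζp.inv)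
  have hord : orderOf (g₀ ^ j) = p := by
    rw [Nat.Coprime.orderOf_pow hcop.symm]
  let Y' : K →ₗ[ℂ] (ℚ → Module.End ℂ M) :=
    { toFun := fun a i => (T a).coeff (-i - 1)
      map_add' := fun a b => by funext i; simp
      map_smul' := fun c a => by funext i; simp }
  have hY' : ∀ u i, Y' u i = (T u).coeff (-i - 1) := fun _ _ => rfl
  refine ⟨g₀ ^ j, G.pow_mem hg₀ j, Y', ?_, fun a => ?_⟩
  · refine isTwistedModule_of_series (T := T) (by rw [hord]; exact hp0) (by rw [hord]; exact hζp)
      hY' (fun u v i k => ?_) hTD ?_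
    · exact hY.modeAlgebra_comm _ (hTS u _) _ (hTS v _)
    · intro r _ u hu i hi
      rw [hord] at hu ⊢
      rw [hY'] at hi
      obtain ⟨k, hk⟩ := hfrac u _ hi
      have h1 := hpow j u (-i - 1)
      rw [hu, map_smul, HahnSeries.coeff_smul] at h1
      have h2 : (ζ p ^ r - expChar (-i - 1) ^ j) • (T u).coeff (-i - 1) = 0 := by
        rw [sub_smul, h1, sub_self]
      have h3 := sub_eq_zero.1 ((smul_eq_zero.1 h2).resolve_right hi)
      rw [hk, expChar_div, ← hωdef, ← zpow_natCast, ← zpow_natCast, ← zpow_mul, mul_comm k,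
        zpow_mul, zpow_natCast ω, hj, inv_zpow, ← mul_eq_one_iff_eq_inv₀ (zpow_ne_zero _
          (hζp.ne_zero hp0.ne')), ← zpow_add₀ (hζp.ne_zero hp0.ne'),
        hζp.zpow_eq_one_iff_dvd] at h3
      obtain ⟨c, hc⟩ := h3
      have hc' : (r : ℚ) + k = p * c := by exact_mod_cast hc
      refine ⟨-c - 1, ?_⟩
      push_cast
      field_simp
      field_simp at hk
      linarith
  · funext i
    rw [hY', hTF, show -(-i - 1) - 1 = i by ring]

end Existence

/-! ### The four assertions. -/

/-- The modes of a nonzero module over a field determine the element. -/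
theorem series_injective {K M : Type*} [Field K] [Algebra ℂ K] [AddCommGroup M] [Module ℂ M]
    [Nontrivial M] {T : K →ₐ[ℂ] HahnSeries ℚ (Module.End ℂ M)}
    {Y : K →ₗ[ℂ] (ℚ → Module.End ℂ M)} (hT : ∀ a q, (T a).coeff q = Y a (-q - 1)) :
    Function.Injective Y := fun a b h => T.toRingHom.injective <| by
  change T a = T b
  ext1; funext q
  rw [hT, hT, h]

end DiffVertex

theorem theorem3p1 {K M : Type*} [Field K] [Algebra ℂ K] [AddCommGroup M] [Module ℂ M]
    (ζ : ℕ → ℂ) (hζ : ∀ p : ℕ, 0 < p → IsPrimitiveRoot (ζ p) p)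
    (D : Derivation ℂ K K) (G : Subgroup (K ≃ₐ[ℂ] K)) [Finite G]
    (hD : ∀ g ∈ G, ∀ a : K, g (D a) = D (g a))
    [FiniteDimensional ℂ M] [Nontrivial M]
    (Y : IntermediateField.fixedField G →ₗ[ℂ] (ℚ → Module.End ℂ M))
    (hY : DiffVertex.IsVertexModule (DiffVertex.fixedDerivation D G hD) Y)
    (hindec : DiffVertex.IsIndecomposable Y) :
    (∃ g ∈ G, ∃ Y' : K →ₗ[ℂ] (ℚ → Module.End ℂ M),
      DiffVertex.IsTwistedStructureOver ζ D G Y g Y') ∧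
    (∀ g ∈ G, ∀ Y₁ Y₂ : K →ₗ[ℂ] (ℚ → Module.End ℂ M),
      DiffVertex.IsTwistedStructureOver ζ D G Y g Y₁ →
      DiffVertex.IsTwistedStructureOver ζ D G Y g Y₂ →
      DiffVertex.psi Y₁ = DiffVertex.psi Y₂ → DiffVertex.Isomorphic Y₁ Y₂) ∧
    (∀ g ∈ G, ∀ Y' : K →ₗ[ℂ] (ℚ → Module.End ℂ M),
      DiffVertex.IsTwistedStructureOver ζ D G Y g Y' →
      Function.Injective (fun h : G => DiffVertex.translate Y' (h : K ≃ₐ[ℂ] K)) ∧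
      ∀ h ∈ G, ∃ Φ : K →ₐ[ℂ] LaurentSeries (Module.End ℂ M), ∀ (a : K) (n : ℤ),
        (Φ a).coeff n = DiffVertex.translate Y' h a (-((n : ℚ) / (orderOf g : ℚ)) - 1)) ∧
    (∀ g₁ ∈ G, ∀ g₂ ∈ G, ∀ Y₁ Y₂ : K →ₗ[ℂ] (ℚ → Module.End ℂ M),
      DiffVertex.IsTwistedStructureOver ζ D G Y g₁ Y₁ →
      DiffVertex.IsTwistedStructureOver ζ D G Y g₂ Y₂ →
      ∃ h ∈ G, h⁻¹ * g₁ * h = g₂ ∧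
        DiffVertex.Isomorphic (DiffVertex.translate Y₁ h) Y₂) := by
  refine ⟨DiffVertex.exists_twistedStructure hζ hY hindec, ?_, ?_, ?_⟩
  · intro g hg Y₁ Y₂ h₁ h₂ hpsi
    obtain ⟨T₁, φ₁, hT₁, hφ₁, hψ₁⟩ := h₁.exists_residue hindec (hζ _ h₁.1.finite_order)
    obtain ⟨T₂, φ₂, hT₂, hφ₂, hψ₂⟩ := h₂.exists_residue hindec (hζ _ h₂.1.finite_order)
    -- The map `psi` is the reduction `φ` viewed as scalar operators.
    have hφ : φ₁ = φ₂ := by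
      ext a q
      apply (algebraMap ℂ (Module.End ℂ M)).injective
      have e : q = -(-q - 1) - 1 := by ring
      rw [e, ← hψ₁, ← hψ₂, hpsi]
    subst hφ
    have heq := DiffVertex.eq_of_isResidue hY hindec hζ h₁ h₂ hT₁ hT₂ G.one_mem hφ₁ hφ₂
    exact ⟨LinearEquiv.refl ℂ M, fun a i w => by rw [heq]; rfl⟩
  · intro g hg Y' h
    obtain ⟨T, hT⟩ := h.1.exists_series (hζ _ h.1.finite_order)
    refine ⟨fun h₁ h₂ he => ?_, fun σ _ => ?_⟩
    · ext a
      exact DiffVertex.series_injective hT (LinearMap.congr_fun he a)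
    · have hp0 := h.1.finite_order
      have hpQ : (orderOf g : ℚ) ≠ 0 := by exact_mod_cast hp0.ne'
      -- The exponents lie in `(1/|g|)ℤ`, so the series is a Laurent series in `x ^ (1/|g|)`.
      obtain ⟨Φ, hΦ⟩ := DiffVertex.exists_laurent_factor (orderOf g) hp0 T.toRingHom (by
        intro a q hq
        by_contra hk
        change (T a).coeff q ≠ 0 at hq
        rw [hT] at hq
        refine hq (h.1.support a _ ?_)
        rintro ⟨k, hk'⟩
        refine hk ⟨-k - orderOf g, ?_⟩
        push_cast
        field_simp at hk' ⊢
        linarith)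
      have hΦc : ∀ a (n : ℤ), (Φ a).coeff n = Y' a (-((n : ℚ) / (orderOf g : ℚ)) - 1) := by
        intro a n
        rw [← hT, ← DiffVertex.coeff_puiseuxEmb_div (orderOf g) hp0 (Φ a) n, hΦ]
        rfl
      refine ⟨AlgHom.comp { Φ with commutes' := fun c => ?_ } σ.toAlgHom, fun a n => hΦc (σ a) n⟩
      change Φ (algebraMap ℂ K c) = _
      apply DiffVertex.puiseuxEmb_injective (orderOf g) hp0
      rw [hΦ]
      change T (algebraMap ℂ K c) = _
      rw [AlgHom.commutes, HahnSeries.algebraMap_apply, HahnSeries.algebraMap_apply]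
      exact HahnSeries.embDomainRingHom_C.symm
  · intro g₁ hg₁ g₂ hg₂ Y₁ Y₂ h₁ h₂
    obtain ⟨T₁, φ₁, hT₁, hφ₁, -⟩ := h₁.exists_residue hindec (hζ _ h₁.1.finite_order)
    obtain ⟨T₂, φ₂, hT₂, hφ₂, -⟩ := h₂.exists_residue hindec (hζ _ h₂.1.finite_order)
    -- Both series restrict to that of `Y` on `K^G`, and scalar parts are unique, so the residues
    -- agree there.
    obtain ⟨σ, hσ, hσφ⟩ := DiffVertex.exists_mem_of_agree_on_fixedField G (φ₁ := φ₁) (φ₂ := φ₂)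
      (fun a => by
        ext q
        refine DiffVertex.eq_of_isNilpotent_sub (hφ₁ a q) ?_
        have e : T₁.toRingHom (a : K) = T₂.toRingHom (a : K) := by
          change T₁ a = T₂ a
          ext1; funext q
          rw [hT₁, hT₂, h₁.2, h₂.2]
        rw [e]
        exact hφ₂ a q)
    have heq := DiffVertex.eq_of_isResidue hY hindec hζ h₁ h₂ hT₁ hT₂ hσ (fun a q => by
      rw [hσφ]
      exact hφ₁ (σ a) q) hφ₂
    refine ⟨σ, hσ, DiffVertex.IsTwistedModule.conj_eq hζ h₁.1 h₂.1 heq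
      (DiffVertex.series_injective hT₁) (DiffVertex.series_injective hT₂), ?_⟩
    exact ⟨LinearEquiv.refl ℂ M, fun a i w => by rw [heq]; rfl⟩
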